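/- Work over $\mathbb{C}$. Let $T,T'\subset\mathbb{P}^3$ be two trihedra with faces $f_1,f_2,f_3$, respectively $f_1',f_2',f_3'$, and with vertices $v=f_1\cap f_2\cap f_3$ and $v'=f_1'\cap f_2'\cap f_3'$. Assume that they are in general position: no four of the six faces have a common point. Let $\mathcal{K}$ be the linear system of the septic surfaces of $\mathbb{P}^3$ that are double along the six edges $f_i\cap f_j$, $f_i'\cap f_j'$ ($i<j$), i.e. that have multiplicity at least $2$ at each point of these lines. Then $\dim\mathcal{K}=9$. Let $W_F^9\subset\mathbb{P}^9$ be the image of the rational map $\nu:\mathbb{P}^3\dashrightarrow\mathbb{P}^9$ defined by $\mathcal{K}$, i.e. the Zariski closure of the image of the complement of the base locus (with respect to any basis of the vector space of septic forms defining $\mathcal{K}$). Two distinct singular points of $W_F^9$ are said to be associated if the line joining them is contained in $W_F^9$. Then each singular point of $W_F^9$ is associated with at least four other singular points of $W_F^9$. Moreover, for each singular point $p$ there are at least four other singular points $q$ such that the line $\langle p,q\rangle\subset W_F^9$ is the image of one of the following: - the divisor $\Gamma_i$, for $i\in\{1,2,3\}$, over the vertex $v$: blow up $v$ and then the line cut out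 on the exceptional plane by the strict transform of $f_i$; $\Gamma_i$ is the second exceptional divisor; - the divisor $\Gamma_i'$ over the vertex $v'$, defined in the same way by $f_i'$; - the divisor $\Lambda_{ijk,h}$, for $i\ne j$, $h\in\{i,j\}$, over the point $f_i\cap f_j\cap f_k'$, defined in the same way by $f_h$; or the divisor $\Lambda_{ijk,h}'$ over the point $f_i'\cap f_j'\cap f_k$, defined in the same way by $f_h'$; - the strict transform of the line $\langle v,v'\rangle$. Here, if the point $o$ is the intersection of the planes $g_1=0$, $g_2=0$, $g_3=0$ and the second centre is defined by $g_1$, the image of the second exceptional divisor is the Zariski closure of the set of all $\lim_{t\to0}\nu(x(t))$ along arcs $x(t)$ with $x(0)=o$, $g_1(x(t))=\alpha t^2$, $g_2(x(t))=\beta t$, $g_3(x(t))=\gamma t$, with $\alpha,\beta,\gamma\neq 0$. The image of the strict transform of $\langle v,v'\rangle$ is the Zariski closure of the image under $\nu$ of the points of this line outside the base locus. -/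

import Mathlib

open scoped LinearAlgebra.Projectivization Topology

noncomputable section

namespace FanoGenusNine

/-! ### Projective varieties over the complex numbers -/

/-- The projective space `ℙ^(n-1)` over `ℂ`, with homogeneous coordinates indexed by `Fin n`. -/
abbrev PSpace (n : ℕ) : Type := ℙ ℂ (Fin n → ℂ)

/-- The (punctured) affine cone over a set of points of projective space: all vectors of
homogeneous coordinates of all points of `S`. -/
def coneOver {n : ℕ} (S : Set (PSpace n)) : Set (Fin n → ℂ) :=
  {y | ∃ hy : y ≠ 0, Projectivization.mk ℂ y hy ∈ S}

/-- The homogeneous ideal of a set `S` of points of projective space. (A polynomial vanishes at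
all vectors of homogeneous coordinates of a point exactly if each of its homogeneous components
does, so this ideal is homogeneous.) -/
def homogeneousIdeal {n : ℕ} (S : Set (PSpace n)) : Ideal (MvPolynomial (Fin n) ℂ) :=
  MvPolynomial.vanishingIdeal ℂ (coneOver S)

/-- The closure of `S` in the Zariski topology of projective space. -/
def zariskiClosure {n : ℕ} (S : Set (PSpace n)) : Set (PSpace n) :=
  {p | p.rep ∈ MvPolynomial.zeroLocus ℂ (homogeneousIdeal S)}

/-- The Zariski tangent space at `p.rep` of the affine cone over `W`. For `p ∈ W` its dimension is
one more than the dimension of the Zariski tangent space of `W` at `p`. -/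
def coneTangentSpace {n : ℕ} (W : Set (PSpace n)) (p : PSpace n) : Submodule ℂ (Fin n → ℂ) where
  carrier := {w | ∀ F ∈ homogeneousIdeal W,
    ∑ i, MvPolynomial.eval p.rep (MvPolynomial.pderiv i F) * w i = 0}
  add_mem' := by
    intro a b ha hb F hF
    simp only [Pi.add_apply, mul_add, Finset.sum_add_distrib, ha F hF, hb F hF, add_zero]
  zero_mem' := by
    intro F _
    simp
  smul_mem' := by
    intro c a ha F hF
    have h := congrArg (fun z => c * z) (ha F hF)
    simp only [Finset.mul_sum, mul_zero] at h
    rw [← h]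
    refine Finset.sum_congr rfl fun i _ => ?_
    simp only [Pi.smul_apply, smul_eq_mul]
    ring

/-- `p` is a singular point of the (irreducible, closed) projective variety `W`: the Zariski
tangent space at `p` has larger dimension than `W`. Both sides are read on the affine cone, which
adds one to both; the dimension of the cone is the Krull dimension of the homogeneous coordinate
ring of `W`. -/
def IsSingularPoint {n : ℕ} (W : Set (PSpace n)) (p : PSpace n) : Prop :=
  p ∈ W ∧ ringKrullDim (MvPolynomial (Fin n) ℂ ⧸ homogeneousIdeal W) <
    (Module.finrank ℂ (coneTangentSpace W p) : WithBot ℕ∞)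

/-- The line joining two distinct points `p`, `q`. -/
def joiningLine {n : ℕ} (p q : PSpace n) : Set (PSpace n) :=
  {r | r.submodule ≤ p.submodule ⊔ q.submodule}

/-- Two distinct points are associated on `W` if the line joining them is contained in `W`. -/
def AreAssociated {n : ℕ} (W : Set (PSpace n)) (p q : PSpace n) : Prop :=
  p ≠ q ∧ joiningLine p q ⊆ W

/-! ### The two trihedra and the septic surfaces -/

/-- The faces of the two trihedra are the planes `f i = 0` and `f' i = 0` of `ℙ³`. The trihedra
are in general position: no four of the six faces have a common point. -/
def GeneralPosition (f f' : Fin 3 → Module.Dual ℂ (Fin 4 → ℂ)) : Prop :=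
  ∀ s : Finset (Fin 3 ⊕ Fin 3), s.card = 4 →
    LinearIndependent ℂ (fun i : s => Sum.elim f f' (i : Fin 3 ⊕ Fin 3))

/-- The polynomial `F` has multiplicity at least two at every point of the line `g = h = 0`. -/
def IsDoubleAlong (F : MvPolynomial (Fin 4) ℂ) (g h : Module.Dual ℂ (Fin 4 → ℂ)) : Prop :=
  ∀ x : Fin 4 → ℂ, g x = 0 → h x = 0 →
    MvPolynomial.eval x F = 0 ∧ ∀ k, MvPolynomial.eval x (MvPolynomial.pderiv k F) = 0

/-- The vector space of the septic forms that are double along the six edges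
`f i = f j = 0` and `f' i = f' j = 0` of the two trihedra. -/
def septics (f f' : Fin 3 → Module.Dual ℂ (Fin 4 → ℂ)) :
    Submodule ℂ (MvPolynomial (Fin 4) ℂ) where
  carrier := {F | F.IsHomogeneous 7 ∧
    ∀ i j, i ≠ j → IsDoubleAlong F (f i) (f j) ∧ IsDoubleAlong F (f' i) (f' j)}
  add_mem' := by
    rintro F G ⟨hF, hF'⟩ ⟨hG, hG'⟩
    refine ⟨hF.add hG, fun i j hij => ⟨fun x h1 h2 => ?_, fun x h1 h2 => ?_⟩⟩
    · obtain ⟨a, b⟩ := (hF' i j hij).1 x h1 h2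
      obtain ⟨c, d⟩ := (hG' i j hij).1 x h1 h2
      exact ⟨by simp [a, c], fun k => by simp [b k, d k]⟩
    · obtain ⟨a, b⟩ := (hF' i j hij).2 x h1 h2
      obtain ⟨c, d⟩ := (hG' i j hij).2 x h1 h2
      exact ⟨by simp [a, c], fun k => by simp [b k, d k]⟩
  zero_mem' := ⟨MvPolynomial.isHomogeneous_zero _ _ _,
    fun i j _ => ⟨fun x _ _ => by simp, fun x _ _ => by simp⟩⟩
  smul_mem' := by
    rintro c F ⟨hF, hF'⟩
    refine ⟨?_, fun i j hij => ⟨fun x h1 h2 => ?_, fun x h1 h2 => ?_⟩⟩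
    · exact (MvPolynomial.homogeneousSubmodule (Fin 4) ℂ 7).smul_mem c hF
    · obtain ⟨a, b⟩ := (hF' i j hij).1 x h1 h2
      exact ⟨by simp [a], fun k => by simp [b k]⟩
    · obtain ⟨a, b⟩ := (hF' i j hij).2 x h1 h2
      exact ⟨by simp [a], fun k => by simp [b k]⟩

/-! ### The rational map of the linear system and its image -/

section Map

variable {f f' : Fin 3 → Module.Dual ℂ (Fin 4 → ℂ)}

/-- The homogeneous coordinates of the image of `x` under the rational map `ℙ³ ⇢ ℙ⁹` given by the
basis `b` of the linear system. -/
def nu (b : Module.Basis (Fin 10) ℂ (septics f f')) (x : Fin 4 → ℂ) : Fin 10 → ℂ :=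
  fun j => MvPolynomial.eval x (b j : MvPolynomial (Fin 4) ℂ)

/-- The closure in `ℙ⁹` of the image, under the rational map, of the points of `ℙ³` in `L` at which
the linear system has no base point. -/
def closedImage (b : Module.Basis (Fin 10) ℂ (septics f f')) (L : Set (Fin 4 → ℂ)) :
    Set (PSpace 10) :=
  zariskiClosure {p | ∃ x ∈ L, ∃ h : nu b x ≠ 0, p = Projectivization.mk ℂ (nu b x) h}

/-- The threefold `W_F⁹ ⊂ ℙ⁹`: the image of the rational map of the linear system. -/
def fanoThreefold (b : Module.Basis (Fin 10) ℂ (septics f f')) : Set (PSpace 10) :=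
  closedImage b Set.univ

/-- Let `o` be the point `g₁ = g₂ = g₃ = 0` of `ℙ³`, for independent linear forms `g₁`, `g₂`, `g₃`.
Blow up `o`, then blow up the curve cut out on the exceptional plane by the strict transform of
the plane `g₁ = 0`. This is the (closed) image in `ℙ⁹` of the exceptional divisor of the second
blow-up: the closure of the set of limits, for `t → 0`, of the image of arcs
`g₁ = α t²`, `g₂ = β t`, `g₃ = γ t` through `o` with `α`, `β`, `γ` nonzero. These are the arcs whose
strict transform passes at `t = 0` through the point of the exceptional divisor with coordinates
`α / β²`, `γ / β`. -/
def exceptionalImage (b : Module.Basis (Fin 10) ℂ (septics f f'))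
    (g₁ g₂ g₃ : Module.Dual ℂ (Fin 4 → ℂ)) : Set (PSpace 10) :=
  zariskiClosure {p | ∃ α β γ : ℂ, α ≠ 0 ∧ β ≠ 0 ∧ γ ≠ 0 ∧
    ∃ x : ℂ → Fin 4 → ℂ, Continuous x ∧ x 0 ≠ 0 ∧
      (∀ t, g₁ (x t) = α * t ^ 2 ∧ g₂ (x t) = β * t ∧ g₃ (x t) = γ * t) ∧
      ∃ c : ℂ → ℂ, Filter.Tendsto (fun t => c t • nu b (x t)) (𝓝[≠] 0) (𝓝 p.rep)}

/-- The line of `ℙ³` joining the vertices `f 0 = f 1 = f 2 = 0` and `f' 0 = f' 1 = f' 2 = 0` of the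
two trihedra (as a set of vectors). -/
def vertexLine (f f' : Fin 3 → Module.Dual ℂ (Fin 4 → ℂ)) : Set (Fin 4 → ℂ) :=
  {x | ∃ u w : Fin 4 → ℂ, (∀ i, f i u = 0) ∧ (∀ i, f' i w = 0) ∧ x = u + w}

/-- The subsets of `ℙ⁹` that are the image of one of

* the divisor `Γ_i` over the vertex `v` of the first trihedron, attached to its face `f_i`;
* the divisor `Γ'_i` over the vertex `v'` of the second trihedron, attached to its face `f'_i`;
* the divisor `Λ_{hjk,h}` over the point `f_h = f_j = f'_k = 0`, attached to the face `f_h`;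
* the divisor `Λ'_{hjk,h}` over the point `f'_h = f'_j = f_k = 0`, attached to the face `f'_h`;
* the strict transform of the line joining `v` and `v'`. -/
inductive IsDistinguishedImage (b : Module.Basis (Fin 10) ℂ (septics f f')) :
    Set (PSpace 10) → Prop
  | gamma (i j k : Fin 3) (hij : i ≠ j) (hik : i ≠ k) (hjk : j ≠ k) :
      IsDistinguishedImage b (exceptionalImage b (f i) (f j) (f k))
  | gamma' (i j k : Fin 3) (hij : i ≠ j) (hik : i ≠ k) (hjk : j ≠ k) :
      IsDistinguishedImage b (exceptionalImage b (f' i) (f' j) (f' k))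
  | lambda (h j k : Fin 3) (hhj : h ≠ j) :
      IsDistinguishedImage b (exceptionalImage b (f h) (f j) (f' k))
  | lambda' (h j k : Fin 3) (hhj : h ≠ j) :
      IsDistinguishedImage b (exceptionalImage b (f' h) (f' j) (f k))
  | vertices : IsDistinguishedImage b (closedImage b (vertexLine f f'))

end Map

end FanoGenusNine

end

/-!
Index the six faces `g k` by `Fin 3 ⊕ Fin 3`, write `D` for their product, and let `k`, `l`, `m` be
the three faces of one trihedron.

* *The linear system.* A septic of the system cuts out on the plane `g k = 0` a plane septic that is
  double along two lines and at the three vertices of the triangle cut out by the other trihedron.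
  Such a curve consists of the two lines, counted twice, and the triangle (`plane_septic_eq`), so on
  this plane the septic is a multiple of `S k = D g l g m / g k` (`faceSeptic`). Subtracting
  multiples of the six `S k` gives a septic that vanishes on all faces, that is, a product of `D`
  and a linear form. Hence the four `D x i` and the six `S k` are a basis of the system
  (`GeneralPosition.septicBasis`).

* *Equations of the image.* On division by `D` the rational map becomes `x ↦ (x, r)` with
  `r k = g l g m / g k`, in coordinates `(ξ, r)` on `ℂ⁴ × ℂ⁶` (`GeneralPosition.coords`). So the
  quadrics `r l r m = (g k ξ)²` and `r k g k ξ = g l ξ g m ξ` vanish on the image. They say that,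
  for each trihedron, `r k = u k ²` and `g k ξ = u l u m` for a vector `u` of `ℂ³`.

* *Singular points.* The homogeneous coordinate ring of the image has Krull dimension four
  (`GeneralPosition.ringKrullDim_fanoThreefold`). If neither trihedron has `u = 0`, then
  differentiating the quadrics bounds the tangent space of the cone by dimension four
  (`GeneralPosition.finrank_coneTangentSpace_le`), and the point is smooth. Otherwise the point is
  one of eight nodes (`GeneralPosition.coords_rep_eq`): for each trihedron, the three points with
  only one nonzero coordinate `r k`, and the limit of `(x, r)` at the vertex of the other trihedron.

* *Lines.* The line joining any node of one group of four to any node of the other group is the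
  image of one of the given divisors or of the line joining the vertices, by a computation of limits
  along arcs (`GeneralPosition.exceptionalImage_vertex`,
  `GeneralPosition.exceptionalImage_edge_face`, `GeneralPosition.closedImage_vertexLine`). So these
  16 lines lie on the image. The four lines through a node span a space of dimension five of tangent
  vectors of the cone, and therefore all eight nodes are singular
  (`GeneralPosition.isSingularPoint_node`).
-/

namespace FanoGenusNine

open MvPolynomial

/-! ### Linear forms as polynomials -/

/-- A linear form on `ℂⁿ`, as a homogeneous polynomial of degree one. -/
noncomputable def linForm {n : ℕ} (g : Module.Dual ℂ (Fin n → ℂ)) : MvPolynomial (Fin n) ℂ :=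
  ∑ i, C (g (Pi.single i 1)) * X i

theorem dual_apply_eq_sum {n : ℕ} (g : Module.Dual ℂ (Fin n → ℂ)) (x : Fin n → ℂ) :
    g x = ∑ i, g (Pi.single i 1) * x i := by
  conv_lhs => rw [pi_eq_sum_univ' x]
  rw [map_sum]
  refine Finset.sum_congr rfl fun i _ => ?_
  rw [map_smul, smul_eq_mul, mul_comm]

@[simp]
theorem eval_linForm {n : ℕ} (g : Module.Dual ℂ (Fin n → ℂ)) (x : Fin n → ℂ) :
    eval x (linForm g) = g x := by
  rw [dual_apply_eq_sum g x]
  simp [linForm]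

theorem isHomogeneous_linForm {n : ℕ} (g : Module.Dual ℂ (Fin n → ℂ)) :
    (linForm g).IsHomogeneous 1 :=
  IsHomogeneous.sum _ _ _ fun _ _ => isHomogeneous_C_mul_X _ _

theorem linForm_ne_zero {n : ℕ} {g : Module.Dual ℂ (Fin n → ℂ)} (hg : g ≠ 0) :
    linForm g ≠ 0 := by
  intro h
  refine hg (LinearMap.ext fun x => ?_)
  rw [← eval_linForm, h]
  simp

theorem linForm_prime {n : ℕ} {g : Module.Dual ℂ (Fin n → ℂ)} (hg : g ≠ 0) :
    Prime (linForm g) := by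
  refine (irreducible_of_totalDegree_eq_one
    ((isHomogeneous_linForm g).totalDegree (linForm_ne_zero hg)) fun x hx => ?_).prime
  refine isUnit_iff_ne_zero.2 fun h0 => linForm_ne_zero hg ?_
  ext i
  simpa [h0] using hx i

/-- A polynomial that vanishes on a hyperplane is divisible by its equation. -/
theorem linForm_dvd {n : ℕ} {g : Module.Dual ℂ (Fin n → ℂ)} (hg : g ≠ 0)
    {F : MvPolynomial (Fin n) ℂ} (h : ∀ x, g x = 0 → eval x F = 0) : linForm g ∣ F := by
  have : (Ideal.span {linForm g}).IsPrime :=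
    (Ideal.span_singleton_prime (linForm_ne_zero hg)).2 (linForm_prime hg)
  rw [← Ideal.mem_span_singleton,
    ← IsPrime.vanishingIdeal_zeroLocus (K := ℂ) (Ideal.span {linForm g}),
    mem_vanishingIdeal_iff]
  intro x hx
  have h1 := hx (linForm g) (Ideal.mem_span_singleton_self _)
  rw [aeval_eq_eval, eval_linForm] at h1
  rw [aeval_eq_eval]
  exact h x h1

theorem linForm_not_dvd {n : ℕ} {g h : Module.Dual ℂ (Fin n → ℂ)}
    {x : Fin n → ℂ} (h1 : g x = 0) (h2 : h x ≠ 0) : ¬ linForm g ∣ linForm h := by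
  rintro ⟨Q, hQ⟩
  apply h2
  rw [← eval_linForm, hQ]
  simp [h1]

theorem linForm_isRelPrime {n : ℕ} {g h : Module.Dual ℂ (Fin n → ℂ)} (hg : g ≠ 0)
    {x : Fin n → ℂ} (h1 : g x = 0) (h2 : h x ≠ 0) : IsRelPrime (linForm g) (linForm h) :=
  (linForm_prime hg).irreducible.isRelPrime_iff_not_dvd.2 (linForm_not_dvd h1 h2)

attribute [local instance] MvPolynomial.gradedAlgebra in
/-- A cofactor of a homogeneous polynomial in a homogeneous polynomial is homogeneous. -/
theorem isHomogeneous_of_mul_left {n a b : ℕ} {P Q : MvPolynomial (Fin n) ℂ} (hP0 : P ≠ 0)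
    (hP : P.IsHomogeneous a) (hPQ : (P * Q).IsHomogeneous (a + b)) : Q.IsHomogeneous b := by
  have h1 := DirectSum.coe_decompose_mul_add_of_left_mem (homogeneousSubmodule (Fin n) ℂ)
    (j := b) (b := Q) ((mem_homogeneousSubmodule a P).2 hP)
  have h2 := DirectSum.decompose_of_mem_same (homogeneousSubmodule (Fin n) ℂ)
    ((mem_homogeneousSubmodule (a + b) (P * Q)).2 hPQ)
  rw [h1] at h2
  rw [← mul_left_cancel₀ hP0 h2]
  exact (mem_homogeneousSubmodule _ _).1 (SetLike.coe_mem _)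

theorem eval_smul_of_isHomogeneous {n d : ℕ} {F : MvPolynomial (Fin n) ℂ}
    (hF : F.IsHomogeneous d) (c : ℂ) (x : Fin n → ℂ) :
    eval (c • x) F = c ^ d * eval x F := by
  rw [eval_eq, eval_eq, Finset.mul_sum]
  refine Finset.sum_congr rfl fun m hm => ?_
  have := hF.degree_eq_sum_deg_support hm
  simp only [Pi.smul_apply, smul_eq_mul, mul_pow, Finset.prod_mul_distrib]
  rw [Finset.prod_pow_eq_pow_sum, show ∑ i ∈ m.support, m i = d from this.symm]
  ring

/-! ### Directional derivatives and double points -/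

/-- The derivative at `p`, in the direction `w`, of the polynomial function `F`. -/
noncomputable def dirDeriv {n : ℕ} (F : MvPolynomial (Fin n) ℂ) (p w : Fin n → ℂ) : ℂ :=
  ∑ i, eval p (pderiv i F) * w i

theorem dirDeriv_mul {n : ℕ} (F G : MvPolynomial (Fin n) ℂ) (p w : Fin n → ℂ) :
    dirDeriv (F * G) p w = dirDeriv F p w * eval p G + eval p F * dirDeriv G p w := by
  simp only [dirDeriv, pderiv_mul, map_add, map_mul, Finset.sum_mul, Finset.mul_sum,
    ← Finset.sum_add_distrib]
  exact Finset.sum_congr rfl fun i _ => by ring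

theorem dirDeriv_add {n : ℕ} (F G : MvPolynomial (Fin n) ℂ) (p w : Fin n → ℂ) :
    dirDeriv (F + G) p w = dirDeriv F p w + dirDeriv G p w := by
  simp only [dirDeriv, map_add, add_mul, Finset.sum_add_distrib]

theorem dirDeriv_sub {n : ℕ} (F G : MvPolynomial (Fin n) ℂ) (p w : Fin n → ℂ) :
    dirDeriv (F - G) p w = dirDeriv F p w - dirDeriv G p w := by
  simp only [dirDeriv, map_sub, sub_mul, Finset.sum_sub_distrib]

@[simp]
theorem dirDeriv_C {n : ℕ} (a : ℂ) (p w : Fin n → ℂ) : dirDeriv (C a) p w = 0 := by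
  simp [dirDeriv]

@[simp]
theorem dirDeriv_X {n : ℕ} (i : Fin n) (p w : Fin n → ℂ) : dirDeriv (X i) p w = w i := by
  simp [dirDeriv, pderiv_X, Pi.single_apply, apply_ite]

@[simp]
theorem dirDeriv_linForm {n : ℕ} (g : Module.Dual ℂ (Fin n → ℂ)) (p w : Fin n → ℂ) :
    dirDeriv (linForm g) p w = g w := by
  rw [dual_apply_eq_sum g w]
  simp [dirDeriv, linForm, pderiv_X, Pi.single_apply, apply_ite]

theorem dirDeriv_single {n : ℕ} (F : MvPolynomial (Fin n) ℂ) (p : Fin n → ℂ) (i : Fin n) :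
    dirDeriv F p (Pi.single i 1) = eval p (pderiv i F) := by
  simp [dirDeriv, Pi.single_apply]

theorem hasDerivAt_eval_line {n : ℕ} (F : MvPolynomial (Fin n) ℂ) (p w : Fin n → ℂ) :
    HasDerivAt (fun t : ℂ => eval (p + t • w) F) (dirDeriv F p w) 0 := by
  induction F using MvPolynomial.induction_on with
  | C a => simpa using hasDerivAt_const (0 : ℂ) a
  | add F G hF hG =>
    rw [dirDeriv_add]
    simp only [map_add]
    exact hF.add hG
  | mul_X F i hF =>
    have h : HasDerivAt (fun t : ℂ => p i + t * w i) (w i) 0 := by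
      simpa using ((hasDerivAt_id (0 : ℂ)).mul_const (w i)).const_add (p i)
    rw [dirDeriv_mul]
    simp only [map_mul, eval_X, dirDeriv_X, Pi.add_apply, Pi.smul_apply, smul_eq_mul]
    simpa using! hF.mul h

/-- `F` has multiplicity at least two at `x`. -/
def IsDoubleAt {n : ℕ} (F : MvPolynomial (Fin n) ℂ) (x : Fin n → ℂ) : Prop :=
  eval x F = 0 ∧ ∀ w, dirDeriv F x w = 0

theorem isDoubleAlong_iff (F : MvPolynomial (Fin 4) ℂ) (g h : Module.Dual ℂ (Fin 4 → ℂ)) :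
    IsDoubleAlong F g h ↔ ∀ x, g x = 0 → h x = 0 → IsDoubleAt F x := by
  refine forall_congr' fun x => forall_congr' fun _ => forall_congr' fun _ =>
    and_congr_right fun _ => ⟨fun H w => ?_, fun H k => ?_⟩
  · simp [dirDeriv, H]
  · rw [← dirDeriv_single, H]

theorem IsDoubleAt.mul {n : ℕ} {P Q : MvPolynomial (Fin n) ℂ} {x : Fin n → ℂ}
    (hP : eval x P = 0) (hQ : eval x Q = 0) : IsDoubleAt (P * Q) x :=
  ⟨by simp [hP], fun w => by simp [dirDeriv_mul, hP, hQ]⟩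

theorem IsDoubleAt.of_dvd {n : ℕ} {P Q : MvPolynomial (Fin n) ℂ} {x : Fin n → ℂ}
    (h : P ∣ Q) (hP : IsDoubleAt P x) : IsDoubleAt Q x := by
  obtain ⟨R, rfl⟩ := h
  exact ⟨by simp [hP.1], fun w => by simp [dirDeriv_mul, hP.1, hP.2 w]⟩

theorem IsDoubleAt.of_mul {n : ℕ} {P Q : MvPolynomial (Fin n) ℂ} {x : Fin n → ℂ}
    (hP : eval x P ≠ 0) (h : IsDoubleAt (P * Q) x) : IsDoubleAt Q x := by
  have h0 : eval x Q = 0 := by simpa [hP] using h.1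
  refine ⟨h0, fun w => ?_⟩
  have := h.2 w
  rw [dirDeriv_mul, h0] at this
  simpa [hP] using this

theorem linForm_sq_dvd {n : ℕ} {g : Module.Dual ℂ (Fin n → ℂ)} (hg : g ≠ 0)
    {F : MvPolynomial (Fin n) ℂ} (h : ∀ x, g x = 0 → IsDoubleAt F x) : linForm g ^ 2 ∣ F := by
  obtain ⟨Q, rfl⟩ := linForm_dvd hg fun x hx => (h x hx).1
  obtain ⟨w, hw⟩ : ∃ w, g w ≠ 0 := by
    by_contra! H
    exact hg (LinearMap.ext H)
  rw [pow_two]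
  refine mul_dvd_mul_left _ (linForm_dvd hg fun x hx => ?_)
  have := (h x hx).2 w
  rw [dirDeriv_mul] at this
  simpa [hx, hw] using this

/-! ### Restriction to a linear subspace -/

/-- The pull-back of a polynomial under a linear map. -/
noncomputable def pullback {m n : ℕ} (σ : (Fin m → ℂ) →ₗ[ℂ] (Fin n → ℂ))
    (F : MvPolynomial (Fin n) ℂ) : MvPolynomial (Fin m) ℂ :=
  aeval (fun k => linForm (LinearMap.proj k ∘ₗ σ)) F

@[simp]
theorem eval_pullback {m n : ℕ} (σ : (Fin m → ℂ) →ₗ[ℂ] (Fin n → ℂ))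
    (F : MvPolynomial (Fin n) ℂ) (x : Fin m → ℂ) :
    eval x (pullback σ F) = eval (σ x) F := by
  induction F using MvPolynomial.induction_on with
  | C a => simp [pullback]
  | add F G hF hG => simp_all [pullback]
  | mul_X F i hF => simp_all [pullback]

theorem dirDeriv_pullback {m n : ℕ} (σ : (Fin m → ℂ) →ₗ[ℂ] (Fin n → ℂ))
    (F : MvPolynomial (Fin n) ℂ) (x w : Fin m → ℂ) :
    dirDeriv (pullback σ F) x w = dirDeriv F (σ x) (σ w) := by
  have h := hasDerivAt_eval_line (pullback σ F) x w
  simp only [eval_pullback, map_add, map_smul] at h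
  exact h.unique (hasDerivAt_eval_line F (σ x) (σ w))

theorem isHomogeneous_pullback {m n d : ℕ} (σ : (Fin m → ℂ) →ₗ[ℂ] (Fin n → ℂ))
    {F : MvPolynomial (Fin n) ℂ} (hF : F.IsHomogeneous d) : (pullback σ F).IsHomogeneous d := by
  have h := hF.aeval (R := ℂ) (n := 1) (fun k => linForm (LinearMap.proj k ∘ₗ σ))
    fun k => isHomogeneous_linForm _
  rwa [one_mul] at h

theorem IsDoubleAt.pullback {m n : ℕ} {σ : (Fin m → ℂ) →ₗ[ℂ] (Fin n → ℂ)}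
    {F : MvPolynomial (Fin n) ℂ} {x : Fin m → ℂ} (h : IsDoubleAt F (σ x)) :
    IsDoubleAt (pullback σ F) x :=
  ⟨by rw [eval_pullback, h.1], fun w => by rw [dirDeriv_pullback, h.2]⟩

/-! ### Plane curves with prescribed double points -/

theorem eval_single_of_isHomogeneous {n d : ℕ} {F : MvPolynomial (Fin n) ℂ}
    (hF : F.IsHomogeneous d) (i : Fin n) :
    eval (Pi.single i 1) F = coeff (Finsupp.single i d) F := by
  rw [eval_eq, Finset.sum_eq_single (Finsupp.single i d)]
  · rw [Finset.prod_eq_one, mul_one]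
    intro j hj
    have := Finsupp.support_single_subset hj
    simp_all
  · intro m hm hne
    have hdeg : m.degree = d := by
      by_contra h
      exact mem_support_iff.1 hm (hF.coeff_eq_zero h)
    obtain ⟨j, hj, hji⟩ : ∃ j ∈ m.support, j ≠ i := by
      by_contra! H
      apply hne
      have hs : m = Finsupp.single i (m i) := by
        refine Finsupp.support_subset_singleton.1 fun j hj => ?_
        simp [H j hj]
      rw [hs, Finsupp.degree_single] at hdeg
      rw [hs, hdeg]
    rw [Finset.prod_eq_zero hj, mul_zero]
    simp [hji, Finsupp.mem_support_iff.1 hj]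
  · intro h
    rw [notMem_support_iff.1 h, zero_mul]

/-- The plane cubics that are double at the three coordinate points are the multiples of the
coordinate triangle. -/
theorem cubic_eq_of_isDoubleAt {H : MvPolynomial (Fin 3) ℂ} (hH : H.IsHomogeneous 3)
    (hd : ∀ i, IsDoubleAt H (Pi.single i 1)) : ∃ c : ℂ, H = C c * (X 0 * X 1 * X 2) := by
  have key : ∀ i j : Fin 3, coeff (Finsupp.single i 2 + Finsupp.single j 1) H = 0 := by
    intro i j
    have h1 := (hd i).2 (Pi.single j 1)
    rw [dirDeriv_single, eval_single_of_isHomogeneous (hH.pderiv (i := j)), coeff_pderiv] at h1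
    exact (mul_eq_zero.1 h1).resolve_right (Nat.cast_add_one_ne_zero _)
  let m : Fin 3 →₀ ℕ := Finsupp.equivFunOnFinite.symm fun _ => 1
  have hm : (X 0 * X 1 * X 2 : MvPolynomial (Fin 3) ℂ) = monomial m 1 := by
    rw [X, X, X, monomial_mul, monomial_mul]
    have hs : Finsupp.single 0 1 + Finsupp.single 1 1 + Finsupp.single 2 1 = m := by
      ext i
      fin_cases i <;> simp [m]
    rw [one_mul, one_mul, hs]
  refine ⟨coeff m H, ?_⟩
  rw [hm, C_mul_monomial, mul_one]
  ext e
  rw [coeff_monomial]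
  split_ifs with h
  · rw [h]
  · by_contra h0
    have hdeg : e.degree = 3 := by
      by_contra h
      exact h0 (hH.coeff_eq_zero h)
    obtain ⟨i, hi⟩ : ∃ i, 2 ≤ e i := by
      by_contra! H
      apply h
      rw [Finsupp.degree_eq_sum, Fin.sum_univ_three] at hdeg
      ext i
      have := H 0
      have := H 1
      have := H 2
      fin_cases i <;> simp [m] <;> omega
    have hle : Finsupp.single i 2 ≤ e := by simpa using hi
    obtain ⟨r, rfl⟩ := exists_add_of_le hle
    rw [map_add, Finsupp.degree_single] at hdeg
    obtain ⟨j, rfl⟩ : ∃ j, r = Finsupp.single j 1 := by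
      have : r.degree = 1 := by omega
      rw [Finsupp.degree_eq_sum, Fin.sum_univ_three] at this
      have h3 : r 0 = 1 ∧ r 1 = 0 ∧ r 2 = 0 ∨ r 0 = 0 ∧ r 1 = 1 ∧ r 2 = 0 ∨
        r 0 = 0 ∧ r 1 = 0 ∧ r 2 = 1 := by omega
      rcases h3 with h3 | h3 | h3
      · exact ⟨0, by ext i; fin_cases i <;> simp [h3]⟩
      · exact ⟨1, by ext i; fin_cases i <;> simp [h3]⟩
      · exact ⟨2, by ext i; fin_cases i <;> simp [h3]⟩
    exact h0 (key i j)

/-- A plane septic that is double along two lines, and at three points outside these lines that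
are not collinear, consists of the two lines, counted twice, and the triangle of the points. -/
theorem plane_septic_eq {G : MvPolynomial (Fin 3) ℂ} (hG : G.IsHomogeneous 7)
    {a b : Module.Dual ℂ (Fin 3 → ℂ)} (ha : ∀ i, a (Pi.single i 1) ≠ 0)
    (hb : ∀ i, b (Pi.single i 1) ≠ 0) {x : Fin 3 → ℂ} (hax : a x = 0) (hbx : b x ≠ 0)
    (hGa : ∀ x, a x = 0 → IsDoubleAt G x) (hGb : ∀ x, b x = 0 → IsDoubleAt G x)
    (hGi : ∀ i, IsDoubleAt G (Pi.single i 1)) :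
    ∃ c : ℂ, G = linForm a ^ 2 * linForm b ^ 2 * (C c * (X 0 * X 1 * X 2)) := by
  have ha0 : a ≠ 0 := fun h => ha 0 (by simp [h])
  have hb0 : b ≠ 0 := fun h => hb 0 (by simp [h])
  obtain ⟨H, rfl⟩ := ((linForm_isRelPrime ha0 hax hbx).pow (m := 2) (n := 2)).mul_dvd
    (linForm_sq_dvd ha0 hGa) (linForm_sq_dvd hb0 hGb)
  have hH : H.IsHomogeneous 3 := by
    refine isHomogeneous_of_mul_left (a := 4) ?_ ?_ hG
    · exact mul_ne_zero (pow_ne_zero _ (linForm_ne_zero ha0)) (pow_ne_zero _ (linForm_ne_zero hb0))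
    · exact ((isHomogeneous_linForm a).pow 2).mul ((isHomogeneous_linForm b).pow 2)
  obtain ⟨c, rfl⟩ := cubic_eq_of_isDoubleAt hH fun i =>
    (hGi i).of_mul (by simp [ha i, hb i])
  exact ⟨c, rfl⟩

/-! ### The six faces -/

/-- The six faces of the two trihedra. -/
abbrev face (f f' : Fin 3 → Module.Dual ℂ (Fin 4 → ℂ)) :
    Fin 3 ⊕ Fin 3 → Module.Dual ℂ (Fin 4 → ℂ) :=
  Sum.elim f f'

/-- One of the two other faces of the trihedron of the face `k`. -/
def mate₁ : Fin 3 ⊕ Fin 3 → Fin 3 ⊕ Fin 3 := Sum.map (· + 1) (· + 1)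

/-- The third face of the trihedron of the faces `k` and `mate₁ k`. -/
def mate₂ : Fin 3 ⊕ Fin 3 → Fin 3 ⊕ Fin 3 := Sum.map (· + 2) (· + 2)

/-- The three faces of the trihedron that does not contain the face `k`. -/
def opposite (k : Fin 3 ⊕ Fin 3) : Fin 3 → Fin 3 ⊕ Fin 3 :=
  Sum.elim (fun _ => Sum.inr) (fun _ => Sum.inl) k

theorem surjective_pi_of_linearIndependent {n : ℕ} {ι : Type*} [Fintype ι]
    {g : ι → Module.Dual ℂ (Fin n → ℂ)} (hg : LinearIndependent ℂ g) :
    Function.Surjective (LinearMap.pi g) := by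
  classical
  rw [← LinearMap.range_eq_top]
  by_contra hne
  obtain ⟨φ, hφ0, hφ⟩ := Submodule.exists_le_ker_of_lt_top _ (lt_top_iff_ne_top.2 hne)
  apply hφ0
  have h0 : ∑ i, φ (Pi.single i 1) • g i = 0 := by
    refine LinearMap.ext fun x => ?_
    have h1 : φ (LinearMap.pi g x) = 0 := hφ ⟨x, rfl⟩
    rw [pi_eq_sum_univ' (LinearMap.pi g x), map_sum] at h1
    simp only [map_smul, smul_eq_mul, LinearMap.pi_apply] at h1
    simp only [LinearMap.sum_apply, LinearMap.smul_apply, smul_eq_mul, LinearMap.zero_apply]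
    rw [← h1]
    exact Finset.sum_congr rfl fun i _ => mul_comm _ _
  refine LinearMap.pi_ext' fun i => LinearMap.ext_ring ?_
  simpa using Fintype.linearIndependent_iff.1 hg _ h0 i

section Faces

variable {f f' : Fin 3 → Module.Dual ℂ (Fin 4 → ℂ)}

theorem GeneralPosition.linearIndependent (h : GeneralPosition f f')
    {e : Fin 4 → Fin 3 ⊕ Fin 3} (he : Function.Injective e) :
    LinearIndependent ℂ fun i => face f f' (e i) := by
  have := h (Finset.univ.map ⟨e, he⟩) (by simp)
  exact this.comp (fun i => ⟨e i, by simp⟩) fun i j hij => he (by simpa using hij)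

theorem GeneralPosition.exists_point (h : GeneralPosition f f')
    {e : Fin 4 → Fin 3 ⊕ Fin 3} (he : Function.Injective e) (y : Fin 4 → ℂ) :
    ∃ x, ∀ i, face f f' (e i) x = y i := by
  obtain ⟨x, hx⟩ := surjective_pi_of_linearIndependent (h.linearIndependent he) y
  exact ⟨x, fun i => congrFun hx i⟩

theorem GeneralPosition.eq_zero (h : GeneralPosition f f')
    {e : Fin 4 → Fin 3 ⊕ Fin 3} (he : Function.Injective e) {x : Fin 4 → ℂ}
    (hx : ∀ i, face f f' (e i) x = 0) : x = 0 := by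
  have h1 := surjective_pi_of_linearIndependent (h.linearIndependent he)
  have h2 := LinearMap.injective_iff_surjective.2 h1
  exact h2 (by rw [map_zero]; exact funext hx)

theorem GeneralPosition.face_ne_zero (h : GeneralPosition f f') (k : Fin 3 ⊕ Fin 3) :
    face f f' k ≠ 0 := by
  have he : Function.Injective ![k, mate₁ k, mate₂ k, opposite k 0] := by
    revert k; decide
  simpa using (h.linearIndependent he).ne_zero 0

theorem GeneralPosition.exists_eq_zero_ne_zero (h : GeneralPosition f f')
    {a b : Fin 3 ⊕ Fin 3} (hab : a ≠ b) : ∃ x, face f f' a x = 0 ∧ face f f' b x ≠ 0 := by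
  obtain ⟨c, d, he⟩ : ∃ c d, Function.Injective ![a, b, c, d] := by
    revert a b; decide
  obtain ⟨x, hx⟩ := h.exists_point he ![0, 1, 0, 0]
  exact ⟨x, hx 0, by simpa using (hx 1).trans_ne one_ne_zero⟩

theorem IsDoubleAt.of_mem_septics {F : MvPolynomial (Fin 4) ℂ} (hF : F ∈ septics f f')
    {a b : Fin 3 ⊕ Fin 3} (hab : a ≠ b) (hs : a.isLeft = b.isLeft) {x : Fin 4 → ℂ}
    (ha : face f f' a x = 0) (hb : face f f' b x = 0) : IsDoubleAt F x := by
  rcases a with i | i <;> rcases b with j | j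
  · exact (isDoubleAlong_iff _ _ _).1 (hF.2 i j (by simpa using hab)).1 x ha hb
  · simp at hs
  · simp at hs
  · exact (isDoubleAlong_iff _ _ _).1 (hF.2 i j (by simpa using hab)).2 x ha hb

theorem mem_septics {F : MvPolynomial (Fin 4) ℂ} (hF : F.IsHomogeneous 7)
    (h : ∀ (a b : Fin 3 ⊕ Fin 3) (x : Fin 4 → ℂ), a ≠ b → a.isLeft = b.isLeft →
      face f f' a x = 0 → face f f' b x = 0 → IsDoubleAt F x) : F ∈ septics f f' :=
  ⟨hF, fun i j hij => ⟨(isDoubleAlong_iff _ _ _).2 fun x h1 h2 =>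
      h (Sum.inl i) (Sum.inl j) x (by simpa using hij) rfl h1 h2,
    (isDoubleAlong_iff _ _ _).2 fun x h1 h2 =>
      h (Sum.inr i) (Sum.inr j) x (by simpa using hij) rfl h1 h2⟩⟩

/-! ### A basis of the linear system -/

variable (f f') in
/-- The sextic form that defines the union of the six faces. -/
noncomputable def facesForm : MvPolynomial (Fin 4) ℂ := ∏ k, linForm (face f f' k)

variable (f f') in
/-- The septic that consists of the faces of the trihedron that does not contain the face `k`, and
of the two faces other than `k` of the trihedron of `k`, counted twice. -/
noncomputable def faceSeptic (k : Fin 3 ⊕ Fin 3) : MvPolynomial (Fin 4) ℂ :=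
  (∏ i, linForm (face f f' (opposite k i))) *
    (linForm (face f f' (mate₁ k)) ^ 2 * linForm (face f f' (mate₂ k)) ^ 2)

theorem prod_faces_eq {M : Type*} [CommMonoid M] (G : Fin 3 ⊕ Fin 3 → M) (k : Fin 3 ⊕ Fin 3) :
    ∏ i, G i = (∏ i, G (opposite k i)) * (G k * (G (mate₁ k) * G (mate₂ k))) := by
  rw [Fintype.prod_sum_type]
  rcases k with k | k
  · rw [mul_comm]
    congr 1
    rw [Fin.prod_univ_three]
    fin_cases k
    · exact mul_assoc _ _ _
    · exact (mul_rotate _ _ _).trans (mul_assoc _ _ _)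
    · exact (mul_comm _ _)
  · congr 1
    rw [Fin.prod_univ_three]
    fin_cases k
    · exact mul_assoc _ _ _
    · exact (mul_rotate _ _ _).trans (mul_assoc _ _ _)
    · exact (mul_comm _ _)

theorem isHomogeneous_facesForm : (facesForm f f').IsHomogeneous 6 := by
  have h := IsHomogeneous.prod Finset.univ (fun k => linForm (face f f' k)) (fun _ => 1)
    fun k _ => isHomogeneous_linForm _
  have h6 : ∑ _k : Fin 3 ⊕ Fin 3, 1 = 6 := rfl
  exact h6 ▸ h

theorem isHomogeneous_faceSeptic (k : Fin 3 ⊕ Fin 3) :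
    (faceSeptic f f' k).IsHomogeneous 7 := by
  have h := IsHomogeneous.prod Finset.univ (fun i => linForm (face f f' (opposite k i)))
    (fun _ => 1) fun i _ => isHomogeneous_linForm _
  exact h.mul (((isHomogeneous_linForm _).pow 2).mul ((isHomogeneous_linForm _).pow 2))

theorem facesForm_mul_X_mem (i : Fin 4) : facesForm f f' * X i ∈ septics f f' := by
  refine mem_septics (isHomogeneous_facesForm.mul (isHomogeneous_X ℂ i))
    fun a b x hab _ ha hb => ?_
  refine IsDoubleAt.of_dvd (Dvd.intro _ rfl) ?_
  rw [facesForm, ← Finset.mul_prod_erase _ _ (Finset.mem_univ a)]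
  refine IsDoubleAt.mul (by simpa using ha) ?_
  rw [map_prod]
  exact Finset.prod_eq_zero (Finset.mem_erase.2 ⟨hab.symm, Finset.mem_univ _⟩) (by simpa using hb)

theorem faceSeptic_mem (k : Fin 3 ⊕ Fin 3) : faceSeptic f f' k ∈ septics f f' := by
  refine mem_septics (isHomogeneous_faceSeptic k) fun a b x hab hs ha hb => ?_
  have hcases : a = mate₁ k ∨ a = mate₂ k ∨ b = mate₁ k ∨ b = mate₂ k ∨
      ∃ i j, i ≠ j ∧ a = opposite k i ∧ b = opposite k j := by
    clear ha hb; revert k a b; decide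
  rcases hcases with rfl | rfl | rfl | rfl | ⟨i, j, hij, rfl, rfl⟩
  · exact IsDoubleAt.of_dvd (Dvd.intro_left _ (mul_comm _ _) |>.trans (Dvd.intro_left _ rfl))
      (pow_two (linForm (face f f' (mate₁ k))) ▸ IsDoubleAt.mul (by simpa using ha)
        (by simpa using ha))
  · exact IsDoubleAt.of_dvd ((Dvd.intro_left _ rfl).trans (Dvd.intro_left _ rfl))
      (pow_two (linForm (face f f' (mate₂ k))) ▸ IsDoubleAt.mul (by simpa using ha)
        (by simpa using ha))
  · exact IsDoubleAt.of_dvd (Dvd.intro_left _ (mul_comm _ _) |>.trans (Dvd.intro_left _ rfl))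
      (pow_two (linForm (face f f' (mate₁ k))) ▸ IsDoubleAt.mul (by simpa using hb)
        (by simpa using hb))
  · exact IsDoubleAt.of_dvd ((Dvd.intro_left _ rfl).trans (Dvd.intro_left _ rfl))
      (pow_two (linForm (face f f' (mate₂ k))) ▸ IsDoubleAt.mul (by simpa using hb)
        (by simpa using hb))
  · refine IsDoubleAt.of_dvd (Dvd.intro _ rfl) ?_
    rw [← Finset.mul_prod_erase _ _ (Finset.mem_univ i)]
    refine IsDoubleAt.mul (by simpa using ha) ?_
    rw [map_prod]
    exact Finset.prod_eq_zero (Finset.mem_erase.2 ⟨hij.symm, Finset.mem_univ _⟩)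
      (by simpa using hb)

variable (f f') in
/-- Ten septics of the linear system: the products of the six faces with a coordinate, and the
septics `faceSeptic`. -/
noncomputable def septicFamily : Fin 4 ⊕ (Fin 3 ⊕ Fin 3) → septics f f' :=
  Sum.elim (fun i => ⟨facesForm f f' * X i, facesForm_mul_X_mem i⟩)
    fun k => ⟨faceSeptic f f' k, faceSeptic_mem k⟩

theorem eval_facesForm (x : Fin 4 → ℂ) : eval x (facesForm f f') = ∏ k, face f f' k x := by
  simp [facesForm, map_prod, -Fintype.prod_sum_type]

theorem eval_faceSeptic (x : Fin 4 → ℂ) (k : Fin 3 ⊕ Fin 3) :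
    eval x (faceSeptic f f' k) = (∏ i, face f f' (opposite k i) x) *
      (face f f' (mate₁ k) x ^ 2 * face f f' (mate₂ k) x ^ 2) := by
  simp [faceSeptic, map_prod]

theorem eval_facesForm_eq_zero {x : Fin 4 → ℂ} {k : Fin 3 ⊕ Fin 3} (hx : face f f' k x = 0) :
    eval x (facesForm f f') = 0 := by
  rw [eval_facesForm]
  exact Finset.prod_eq_zero (Finset.mem_univ k) hx

theorem eval_faceSeptic_eq_zero {x : Fin 4 → ℂ} {k m : Fin 3 ⊕ Fin 3} (hkm : k ≠ m)
    (hx : face f f' k x = 0) : eval x (faceSeptic f f' m) = 0 := by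
  rw [eval_faceSeptic]
  have hcases : k = mate₁ m ∨ k = mate₂ m ∨ ∃ i, k = opposite m i := by
    clear hx; revert k m; decide
  rcases hcases with rfl | rfl | ⟨i, rfl⟩
  · simp [hx]
  · simp [hx]
  · rw [Finset.prod_eq_zero (Finset.mem_univ i) hx, zero_mul]

theorem GeneralPosition.facesForm_ne_zero (h : GeneralPosition f f') : facesForm f f' ≠ 0 :=
  Finset.prod_ne_zero_iff.2 fun k _ => linForm_ne_zero (h.face_ne_zero k)

/-- Every septic of the system cuts out on a face a multiple of the curve cut out by the
`faceSeptic` of that face. -/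
theorem GeneralPosition.exists_eval_eq (h : GeneralPosition f f') {F : MvPolynomial (Fin 4) ℂ}
    (hF : F ∈ septics f f') (k : Fin 3 ⊕ Fin 3) :
    ∃ c : ℂ, ∀ x, face f f' k x = 0 → eval x F = c * eval x (faceSeptic f f' k) := by
  -- The faces of the other trihedron are used as coordinates on the plane `face f f' k = 0`.
  have he : Function.Injective (Fin.cons k (opposite k) : Fin 4 → Fin 3 ⊕ Fin 3) := by
    revert k; decide
  have hsurj := surjective_pi_of_linearIndependent (h.linearIndependent he)
  let T := LinearEquiv.ofBijective _ ⟨LinearMap.injective_iff_surjective.2 hsurj, hsurj⟩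
  let ι₀ : (Fin 3 → ℂ) →ₗ[ℂ] (Fin 4 → ℂ) :=
    { toFun := fun y => Fin.cons 0 y
      map_add' := fun y z => by
        ext i
        refine Fin.cases ?_ (fun i => ?_) i <;> simp
      map_smul' := fun c y => by
        ext i
        refine Fin.cases ?_ (fun i => ?_) i <;> simp }
  let σ : (Fin 3 → ℂ) →ₗ[ℂ] (Fin 4 → ℂ) := T.symm.toLinearMap ∘ₗ ι₀
  have hT : ∀ y i, face f f' ((Fin.cons k (opposite k) : Fin 4 → Fin 3 ⊕ Fin 3) i) (σ y) =
      (Fin.cons 0 y : Fin 4 → ℂ) i := fun y i =>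
    congrFun (T.apply_symm_apply (Fin.cons 0 y)) i
  have h0 : ∀ y, face f f' k (σ y) = 0 := fun y => hT y 0
  have hopp : ∀ y i, face f f' (opposite k i) (σ y) = y i := fun y i => by
    simpa using hT y i.succ
  have hσ : ∀ x, face f f' k x = 0 → σ (fun i => face f f' (opposite k i) x) = x := by
    intro x hx
    refine (LinearEquiv.symm_apply_eq T).2 ?_
    ext i
    refine Fin.cases ?_ (fun i => ?_) i
    · exact hx.symm
    · rfl
  have hpt : ∀ m, m = mate₁ k ∨ m = mate₂ k → ∀ i,
      (face f f' m ∘ₗ σ) (Pi.single i 1) ≠ 0 := by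
    intro m hm i hi
    obtain ⟨a, b, ha, hb, hinj⟩ : ∃ a b : Fin 3, a ≠ i ∧ b ≠ i ∧
        Function.Injective ![k, m, opposite k a, opposite k b] := by
      clear * - hm; revert k m i; decide
    have hz : σ (Pi.single i 1) = 0 := by
      refine h.eq_zero hinj fun j => ?_
      fin_cases j
      · exact h0 _
      · exact hi
      · exact (hopp _ _).trans (by simp [ha])
      · exact (hopp _ _).trans (by simp [hb])
    have := hopp (Pi.single i 1) i
    rw [hz] at this
    simp at this
  obtain ⟨x, hx0, hx1, hx2⟩ : ∃ x, face f f' k x = 0 ∧ face f f' (mate₁ k) x = 0 ∧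
      face f f' (mate₂ k) x ≠ 0 := by
    have he : Function.Injective ![k, mate₁ k, mate₂ k, opposite k 0] := by
      clear * -; revert k; decide
    obtain ⟨x, hx⟩ := h.exists_point he ![0, 0, 1, 0]
    exact ⟨x, hx 0, hx 1, by simpa using (hx 2).trans_ne one_ne_zero⟩
  have hk1 : k ≠ mate₁ k ∧ k.isLeft = (mate₁ k).isLeft := by
    clear * -; revert k; decide
  have hk2 : k ≠ mate₂ k ∧ k.isLeft = (mate₂ k).isLeft := by
    clear * -; revert k; decide
  obtain ⟨c, hc⟩ := plane_septic_eq (isHomogeneous_pullback σ hF.1)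
    (a := face f f' (mate₁ k) ∘ₗ σ) (b := face f f' (mate₂ k) ∘ₗ σ)
    (hpt _ (Or.inl rfl)) (hpt _ (Or.inr rfl))
    (x := fun i => face f f' (opposite k i) x) (by simp [hσ x hx0, hx1]) (by simp [hσ x hx0, hx2])
    (fun y hy => (IsDoubleAt.of_mem_septics hF hk1.1 hk1.2 (h0 y) hy).pullback)
    (fun y hy => (IsDoubleAt.of_mem_septics hF hk2.1 hk2.2 (h0 y) hy).pullback)
    (fun i => by
      obtain ⟨a, b, ha, hb, hab, hs⟩ : ∃ a b : Fin 3, a ≠ i ∧ b ≠ i ∧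
          opposite k a ≠ opposite k b ∧ (opposite k a).isLeft = (opposite k b).isLeft := by
        clear * -; revert k i; decide
      exact (IsDoubleAt.of_mem_septics hF hab hs ((hopp _ _).trans (by simp [ha]))
        ((hopp _ _).trans (by simp [hb]))).pullback)
  refine ⟨c, fun x hx => ?_⟩
  have := eval_pullback σ F (fun i => face f f' (opposite k i) x)
  rw [hσ x hx, hc] at this
  rw [← this, eval_faceSeptic, Fin.prod_univ_three]
  simp only [map_mul, map_pow, eval_linForm, LinearMap.comp_apply, eval_C, eval_X, hσ x hx]
  ring

theorem GeneralPosition.linearIndependent_septicFamily (h : GeneralPosition f f') :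
    LinearIndependent ℂ (septicFamily f f') := by
  refine LinearIndependent.of_comp (septics f f').subtype ?_
  refine Fintype.linearIndependent_iff.2 fun c hc => ?_
  have hev : ∀ x, eval x (facesForm f f') * (∑ i, c (Sum.inl i) * x i) +
      ∑ k, c (Sum.inr k) * eval x (faceSeptic f f' k) = 0 := by
    intro x
    have := congrArg (eval x) hc
    rw [Fintype.sum_sum_type, map_add, map_sum, map_sum, map_zero] at this
    rw [← this, Finset.mul_sum]
    congr 1
    · refine Finset.sum_congr rfl fun i _ => ?_
      simp [septicFamily]
      ring
    · refine Finset.sum_congr rfl fun i _ => ?_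
      simp [septicFamily]
  have hr : ∀ k, c (Sum.inr k) = 0 := by
    intro k
    by_contra hk
    have hdvd : linForm (face f f' k) ∣ faceSeptic f f' k := by
      refine linForm_dvd (h.face_ne_zero k) fun x hx => ?_
      have := hev x
      rw [eval_facesForm_eq_zero hx, zero_mul, zero_add, Finset.sum_eq_single k] at this
      · exact (mul_eq_zero.1 this).resolve_left hk
      · intro m _ hm
        rw [eval_faceSeptic_eq_zero hm.symm hx, mul_zero]
      · simp
    have hp := linForm_prime (h.face_ne_zero k)
    have hnot : ∀ m, k ≠ m → ¬ linForm (face f f' k) ∣ linForm (face f f' m) := by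
      intro m hm
      obtain ⟨x, hx1, hx2⟩ := h.exists_eq_zero_ne_zero hm
      exact linForm_not_dvd hx1 hx2
    rcases hp.dvd_or_dvd hdvd with h1 | h1
    · obtain ⟨i, -, hi⟩ := (hp.dvd_finsetProd_iff _).1 h1
      exact hnot _ (by clear * -; revert k i; decide) hi
    · rcases hp.dvd_or_dvd h1 with h1 | h1
      · exact hnot _ (by clear * -; revert k; decide) (hp.dvd_of_dvd_pow h1)
      · exact hnot _ (by clear * -; revert k; decide) (hp.dvd_of_dvd_pow h1)
  have hl : (∑ i, C (c (Sum.inl i)) * X i : MvPolynomial (Fin 4) ℂ) = 0 := by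
    refine (mul_eq_zero.1 (?_ : facesForm f f' * _ = 0)).resolve_left h.facesForm_ne_zero
    refine MvPolynomial.funext fun x => ?_
    have := hev x
    simp only [hr, zero_mul, Finset.sum_const_zero, add_zero] at this
    simpa using this
  rintro (i | k)
  · have := congrArg (eval (Pi.single i 1)) hl
    simpa [Pi.single_apply] using this
  · exact hr k

theorem GeneralPosition.span_septicFamily (h : GeneralPosition f f') :
    ⊤ ≤ Submodule.span ℂ (Set.range (septicFamily f f')) := by
  rintro ⟨F, hF⟩ -
  choose d hd using h.exists_eval_eq hF
  have hhom : (F - ∑ k, C (d k) * faceSeptic f f' k).IsHomogeneous 7 :=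
    hF.1.sub (IsHomogeneous.sum _ _ _ fun k _ => (isHomogeneous_faceSeptic k).C_mul _)
  have hdvd : facesForm f f' ∣ F - ∑ k, C (d k) * faceSeptic f f' k := by
    refine Finset.prod_dvd_of_isRelPrime (fun a _ b _ hab => ?_) fun k _ => ?_
    · obtain ⟨x, hx1, hx2⟩ := h.exists_eq_zero_ne_zero hab
      exact linForm_isRelPrime (h.face_ne_zero a) hx1 hx2
    · refine linForm_dvd (h.face_ne_zero k) fun x hx => ?_
      rw [map_sub, map_sum, Finset.sum_eq_single k, hd k x hx]
      · simp
      · intro m _ hm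
        rw [map_mul, eval_faceSeptic_eq_zero hm.symm hx, mul_zero]
      · simp
  obtain ⟨Q, hQ⟩ := hdvd
  have hQ1 : Q.IsHomogeneous 1 :=
    isHomogeneous_of_mul_left h.facesForm_ne_zero isHomogeneous_facesForm (hQ ▸ hhom)
  rw [← mem_homogeneousSubmodule, homogeneousSubmodule_one_eq_span_X,
    Submodule.mem_span_range_iff_exists_fun] at hQ1
  obtain ⟨c, rfl⟩ := hQ1
  rw [Submodule.mem_span_range_iff_exists_fun]
  refine ⟨Sum.elim c d, Subtype.ext ?_⟩
  rw [sub_eq_iff_eq_add, Finset.mul_sum] at hQ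
  refine Eq.trans ?_ hQ.symm
  rw [Fintype.sum_sum_type]
  simp [septicFamily, -Fintype.sum_sum_type, C_mul']

/-- The basis of the linear system that consists of the septics `septicFamily`. -/
noncomputable def GeneralPosition.septicBasis (h : GeneralPosition f f') :
    Module.Basis (Fin 4 ⊕ (Fin 3 ⊕ Fin 3)) ℂ (septics f f') :=
  Module.Basis.mk h.linearIndependent_septicFamily h.span_septicFamily

theorem GeneralPosition.finrank_septics (h : GeneralPosition f f') :
    Module.finrank ℂ (septics f f') = 10 := by
  simpa using Module.finrank_eq_card_basis h.septicBasis

end Faces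

/-! ### The dimension of an affine algebra over a field -/

theorem ringKrullDim_eq_of_isIntegral {R A : Type*} [CommRing R] [CommRing A] [IsDomain A]
    [Algebra R A]
    [Algebra.IsIntegral R A] (hinj : Function.Injective (algebraMap R A)) :
    ringKrullDim A = ringKrullDim R := by
  refine le_antisymm ?_ ?_
  · exact Order.krullDim_le_of_strictMono (PrimeSpectrum.comap (algebraMap R A))
      fun P Q hPQ => Ideal.IsIntegral.comap_lt_comap hPQ
  · refine iSup_le fun l => ?_
    obtain ⟨P, hP, hPl⟩ := Ideal.exists_ideal_over_prime_of_isIntegral_of_isDomain (S := A)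
      (RelSeries.head l).asIdeal (by rw [(RingHom.injective_iff_ker_eq_bot _).1 hinj]; exact bot_le)
    have : P.LiesOver (RelSeries.head l).asIdeal := ⟨hPl.symm⟩
    obtain ⟨L, hL, -, -⟩ := Ideal.exists_ltSeries_of_hasGoingUp l P
    rw [← hL]
    exact Order.LTSeries.length_le_krullDim L

/-- A finitely generated domain that embeds into a polynomial ring in `m` variables and contains
`m` algebraically independent elements has Krull dimension `m`. -/
theorem ringKrullDim_eq_of_algebraicIndependent {k A : Type} [Field k] [CommRing A] [IsDomain A]
    [Algebra k A] [Algebra.FiniteType k A] {m : ℕ} (φ : A →ₐ[k] MvPolynomial (Fin m) k)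
    (hφ : Function.Injective φ) {z : Fin m → A} (hz : AlgebraicIndependent k z) :
    ringKrullDim A = m := by
  obtain ⟨s, g, hg, hint⟩ := exists_integral_inj_algHom_of_fg k A
  algebraize [g.toRingHom]
  have : IsScalarTower k (MvPolynomial (Fin s) k) A :=
    IsScalarTower.of_algebraMap_eq fun x => (g.commutes x).symm
  have hg' : Function.Injective (algebraMap (MvPolynomial (Fin s) k) A) := hg
  have : FaithfulSMul (MvPolynomial (Fin s) k) A :=
    (faithfulSMul_iff_algebraMap_injective _ _).2 hg'
  have : Algebra.IsIntegral (MvPolynomial (Fin s) k) A := ⟨hint⟩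
  have h1 : s ≤ m := by
    have := trdeg_le_of_injective (φ.comp g) (hφ.comp hg)
    simpa [MvPolynomial.trdeg_of_isDomain] using this
  have h2 : m ≤ s := by
    have h3 := hz.cardinalMk_le_trdeg
    rw [← trdeg_add_eq (R := k) (S := MvPolynomial (Fin s) k) (A := A),
      trdeg_eq_zero (R := MvPolynomial (Fin s) k)] at h3
    simpa [MvPolynomial.trdeg_of_isDomain] using h3
  rw [ringKrullDim_eq_of_isIntegral hg', MvPolynomial.ringKrullDim_of_isNoetherianRing,
    le_antisymm h1 h2]
  simp

/-! ### Closed sets in projective space -/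

theorem mem_homogeneousIdeal {n : ℕ} {S : Set (PSpace n)} {F : MvPolynomial (Fin n) ℂ} :
    F ∈ homogeneousIdeal S ↔
      ∀ (y : Fin n → ℂ) (hy : y ≠ 0), Projectivization.mk ℂ y hy ∈ S → eval y F = 0 := by
  simp only [homogeneousIdeal, mem_vanishingIdeal_iff, coneOver, Set.mem_ofPred_eq, aeval_eq_eval,
    forall_exists_index]

theorem pullback_smul_mem_homogeneousIdeal {n : ℕ} {S : Set (PSpace n)}
    {F : MvPolynomial (Fin n) ℂ} (hF : F ∈ homogeneousIdeal S) {c : ℂ} (hc : c ≠ 0) :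
    pullback (c • LinearMap.id) F ∈ homogeneousIdeal S := by
  rw [mem_homogeneousIdeal] at hF ⊢
  intro y hy hS
  rw [eval_pullback]
  refine hF _ (smul_ne_zero hc hy) ?_
  convert! hS using 1
  exact (Projectivization.mk_eq_mk_iff' ℂ _ _ _ _).2 ⟨c, rfl⟩

theorem mk_mem_zariskiClosure {n : ℕ} {S : Set (PSpace n)} {y : Fin n → ℂ} (hy : y ≠ 0) :
    Projectivization.mk ℂ y hy ∈ zariskiClosure S ↔ ∀ F ∈ homogeneousIdeal S, eval y F = 0 := by
  obtain ⟨a, ha⟩ := Projectivization.exists_smul_eq_mk_rep ℂ y hy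
  simp only [zariskiClosure, Set.mem_ofPred_eq, mem_zeroLocus_iff, aeval_eq_eval, ← ha]
  refine ⟨fun H F hF => ?_, fun H F hF => ?_⟩
  · have := H _ (pullback_smul_mem_homogeneousIdeal hF (c := (a⁻¹ : ℂˣ)) (Units.ne_zero _))
    rw [eval_pullback] at this
    simpa [Units.smul_def] using this
  · have := H _ (pullback_smul_mem_homogeneousIdeal hF (c := a) (Units.ne_zero _))
    rwa [eval_pullback] at this

theorem subset_zariskiClosure {n : ℕ} (S : Set (PSpace n)) : S ⊆ zariskiClosure S := by
  intro p hp
  induction p using Projectivization.ind with | h y hy => ?_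
  exact (mk_mem_zariskiClosure hy).2 fun F hF => mem_homogeneousIdeal.1 hF y hy hp

theorem zariskiClosure_subset {n : ℕ} {S T : Set (PSpace n)} (h : S ⊆ zariskiClosure T) :
    zariskiClosure S ⊆ zariskiClosure T := by
  intro p hp
  induction p using Projectivization.ind with | h y hy => ?_
  refine (mk_mem_zariskiClosure hy).2 fun F hF => (mk_mem_zariskiClosure hy).1 hp F ?_
  exact mem_homogeneousIdeal.2 fun z hz hzS => (mk_mem_zariskiClosure hz).1 (h hzS) F hF

theorem homogeneousIdeal_zariskiClosure {n : ℕ} (S : Set (PSpace n)) :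
    homogeneousIdeal (zariskiClosure S) = homogeneousIdeal S := by
  refine le_antisymm (fun F hF => ?_) fun F hF => ?_
  · exact mem_homogeneousIdeal.2 fun y hy hS =>
      mem_homogeneousIdeal.1 hF y hy (subset_zariskiClosure S hS)
  · exact mem_homogeneousIdeal.2 fun y hy hS => (mk_mem_zariskiClosure hy).1 hS F hF

/-- Zariski closed sets are closed under limits of homogeneous coordinates. -/
theorem mem_zariskiClosure_of_tendsto {n : ℕ} {S : Set (PSpace n)} {p : PSpace n}
    {l : Filter ℂ} [l.NeBot] {y : ℂ → Fin n → ℂ} (hy : Filter.Tendsto y l (𝓝 p.rep))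
    (hS : ∀ t (h : y t ≠ 0), Projectivization.mk ℂ (y t) h ∈ zariskiClosure S) :
    p ∈ zariskiClosure S := by
  rw [← p.mk_rep, mk_mem_zariskiClosure]
  intro F hF
  have h1 : Filter.Tendsto (fun t => eval (y t) F) l (𝓝 (eval p.rep F)) :=
    (F.continuous_eval.tendsto _).comp hy
  refine tendsto_nhds_unique h1 (tendsto_const_nhds.congr' ?_)
  filter_upwards [hy.eventually_ne p.rep_nonzero] with t ht
  exact ((mk_mem_zariskiClosure ht).1 (hS t ht) F hF).symm

theorem mk_mem_joiningLine {n : ℕ} {a b y : Fin n → ℂ} (ha : a ≠ 0) (hb : b ≠ 0) (hy : y ≠ 0) :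
    Projectivization.mk ℂ y hy ∈ joiningLine (.mk ℂ a ha) (.mk ℂ b hb) ↔
      ∃ s t : ℂ, y = s • a + t • b := by
  simp only [joiningLine, Set.mem_ofPred_eq, Projectivization.submodule_mk,
    Submodule.span_singleton_le_iff_mem, Submodule.mem_sup, Submodule.mem_span_singleton]
  constructor
  · rintro ⟨_, ⟨s, rfl⟩, _, ⟨t, rfl⟩, h⟩
    exact ⟨s, t, h.symm⟩
  · rintro ⟨s, t, h⟩
    exact ⟨_, ⟨s, rfl⟩, _, ⟨t, rfl⟩, h.symm⟩

theorem joiningLine_comm {n : ℕ} (p q : PSpace n) : joiningLine p q = joiningLine q p := by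
  simp only [joiningLine, sup_comm]

/-- The Zariski closure of a subset of a line that contains all points of the line, except
possibly two, is the line. -/
theorem zariskiClosure_eq_joiningLine {n : ℕ} {a b : Fin n → ℂ} (ha : a ≠ 0) (hb : b ≠ 0)
    {S : Set (PSpace n)} (h1 : S ⊆ joiningLine (.mk ℂ a ha) (.mk ℂ b hb))
    (h2 : ∀ (s t : ℂ), s ≠ 0 → t ≠ 0 → ∀ h : s • a + t • b ≠ 0,
      Projectivization.mk ℂ (s • a + t • b) h ∈ S) (hab : LinearIndependent ℂ ![a, b]) :
    zariskiClosure S = joiningLine (.mk ℂ a ha) (.mk ℂ b hb) := by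
  refine Set.Subset.antisymm (fun p hp => ?_) fun p hp => ?_
  · induction p using Projectivization.ind with | h y hy => ?_
    rw [mk_mem_joiningLine]
    by_contra hne
    have hnm : y ∉ Submodule.span ℂ {a, b} := by
      rw [Submodule.mem_span_pair]
      rintro ⟨s, t, h⟩
      exact hne ⟨s, t, h.symm⟩
    obtain ⟨φ, hφy, hφ⟩ := Submodule.exists_le_ker_of_notMem hnm
    apply hφy
    rw [← eval_linForm]
    refine (mk_mem_zariskiClosure hy).1 hp _ (mem_homogeneousIdeal.2 fun z hz hzS => ?_)
    obtain ⟨s, t, rfl⟩ := (mk_mem_joiningLine ha hb hz).1 (h1 hzS)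
    rw [eval_linForm]
    exact hφ (Submodule.mem_span_pair.2 ⟨s, t, rfl⟩)
  · induction p using Projectivization.ind with | h y hy => ?_
    obtain ⟨s, t, rfl⟩ := (mk_mem_joiningLine ha hb hy).1 hp
    refine (mk_mem_zariskiClosure hy).2 fun F hF => ?_
    have hz : pullback (Fintype.linearCombination ℂ ![a, b]) F * (X 0 * X 1) = 0 := by
      refine MvPolynomial.funext fun c => ?_
      rw [map_mul, eval_pullback, map_mul, eval_X, eval_X, map_zero, mul_eq_zero, mul_eq_zero]
      by_contra! hc
      refine hc.1 ?_
      have hl : Fintype.linearCombination ℂ ![a, b] c = c 0 • a + c 1 • b := by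
        simp [Fintype.linearCombination_apply]
      rw [hl]
      have hne : c 0 • a + c 1 • b ≠ 0 := fun h0 =>
        hc.2.1 (LinearIndependent.pair_iff.1 hab _ _ h0).1
      exact mem_homogeneousIdeal.1 hF _ hne (h2 _ _ hc.2.1 hc.2.2 hne)
    have hz' := (mul_eq_zero.1 hz).resolve_right (mul_ne_zero (X_ne_zero _) (X_ne_zero _))
    have := eval_pullback (Fintype.linearCombination ℂ ![a, b]) F ![s, t]
    rw [hz'] at this
    simpa [Fintype.linearCombination_apply] using this.symm

section Image

variable {f f' : Fin 3 → Module.Dual ℂ (Fin 4 → ℂ)}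

/-! ### Coordinates on the target of the rational map -/

/-- Linear coordinates on `ℂ¹⁰` that are adapted to the basis `septicBasis`. -/
noncomputable def GeneralPosition.coords (h : GeneralPosition f f')
    (b : Module.Basis (Fin 10) ℂ (septics f f')) :
    (Fin 10 → ℂ) ≃ₗ[ℂ] (Fin 4 → ℂ) × (Fin 3 ⊕ Fin 3 → ℂ) :=
  (b.constr ℂ).trans ((h.septicBasis.constr ℂ).symm.trans
    (LinearEquiv.sumArrowLequivProdArrow (Fin 4) (Fin 3 ⊕ Fin 3) ℂ ℂ))

variable (f f') in
/-- The rational functions that the septics `faceSeptic` become on division by `facesForm`. Where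
the linear form of the face `k` vanishes, the value is zero. -/
noncomputable def ratio (x : Fin 4 → ℂ) (k : Fin 3 ⊕ Fin 3) : ℂ :=
  face f f' (mate₁ k) x * face f f' (mate₂ k) x / face f f' k x

theorem GeneralPosition.coords_nu (h : GeneralPosition f f')
    (b : Module.Basis (Fin 10) ℂ (septics f f')) (x : Fin 4 → ℂ) :
    h.coords b (nu b x) = (eval x (facesForm f f') • x, fun k => eval x (faceSeptic f f' k)) := by
  have h1 : b.constr ℂ (nu b x) = (aeval x).toLinearMap ∘ₗ (septics f f').subtype :=
    b.constr_eq ℂ fun i => by simp [nu]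
  have h2 : ∀ j, (h.septicBasis.constr ℂ).symm (b.constr ℂ (nu b x)) j =
      eval x (septicFamily f f' j : MvPolynomial (Fin 4) ℂ) := by
    intro j
    rw [h1, Module.Basis.constr_symm_apply, GeneralPosition.septicBasis, Module.Basis.mk_apply]
    simp
  refine Prod.ext (funext fun i => (h2 (Sum.inl i)).trans ?_)
    (funext fun k => (h2 (Sum.inr k)).trans ?_)
  · simp [septicFamily]
  · simp [septicFamily]

theorem faces_ne_zero {x : Fin 4 → ℂ} (hx : eval x (facesForm f f') ≠ 0) (k : Fin 3 ⊕ Fin 3) :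
    face f f' k x ≠ 0 :=
  fun h => hx (eval_facesForm_eq_zero h)

theorem eval_faceSeptic_eq {x : Fin 4 → ℂ} (hx : eval x (facesForm f f') ≠ 0)
    (k : Fin 3 ⊕ Fin 3) :
    eval x (faceSeptic f f' k) = eval x (facesForm f f') * ratio f f' x k := by
  have := faces_ne_zero hx k
  rw [eval_faceSeptic, eval_facesForm, prod_faces_eq _ k, ratio]
  field_simp

theorem GeneralPosition.coords_nu_eq_smul (h : GeneralPosition f f')
    (b : Module.Basis (Fin 10) ℂ (septics f f')) {x : Fin 4 → ℂ}
    (hx : eval x (facesForm f f') ≠ 0) :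
    h.coords b (nu b x) = eval x (facesForm f f') • (x, ratio f f' x) := by
  rw [h.coords_nu, Prod.smul_mk]
  congr 1
  ext k
  rw [eval_faceSeptic_eq hx k, Pi.smul_apply, smul_eq_mul]

theorem GeneralPosition.nu_ne_zero (h : GeneralPosition f f')
    (b : Module.Basis (Fin 10) ℂ (septics f f')) {x : Fin 4 → ℂ}
    (hx : eval x (facesForm f f') ≠ 0) : nu b x ≠ 0 := by
  intro h0
  have h1 := h.coords_nu_eq_smul b hx
  rw [h0, map_zero] at h1
  have h2 : x = 0 := (smul_eq_zero.1 (Prod.mk.inj h1).1.symm).resolve_left hx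
  exact faces_ne_zero hx (Sum.inl 0) (by rw [h2, map_zero])

theorem nu_smul (b : Module.Basis (Fin 10) ℂ (septics f f')) (c : ℂ) (x : Fin 4 → ℂ) :
    nu b (c • x) = c ^ 7 • nu b x := by
  ext j
  have hj : (b j : MvPolynomial (Fin 4) ℂ).IsHomogeneous 7 := (b j).2.1
  rw [nu, eval_smul_of_isHomogeneous hj, Pi.smul_apply, smul_eq_mul, nu]

theorem mk_nu_mem (b : Module.Basis (Fin 10) ℂ (septics f f')) {x : Fin 4 → ℂ} {c : ℂ}
    (hx : c • nu b x ≠ 0) : Projectivization.mk ℂ (c • nu b x) hx ∈ fanoThreefold b := by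
  refine subset_zariskiClosure _ ⟨x, trivial, right_ne_zero_of_smul hx, ?_⟩
  exact (Projectivization.mk_eq_mk_iff' ℂ _ _ _ _).2 ⟨c, rfl⟩

/-- The substitution of the septics of the basis `b` for the coordinates of `ℙ⁹`. -/
noncomputable def nuHom (b : Module.Basis (Fin 10) ℂ (septics f f')) :
    MvPolynomial (Fin 10) ℂ →ₐ[ℂ] MvPolynomial (Fin 4) ℂ :=
  aeval fun j => (b j : MvPolynomial (Fin 4) ℂ)

theorem eval_nuHom (b : Module.Basis (Fin 10) ℂ (septics f f')) (F : MvPolynomial (Fin 10) ℂ)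
    (x : Fin 4 → ℂ) : eval x (nuHom b F) = eval (nu b x) F := by
  induction F using MvPolynomial.induction_on with
  | C a => simp [nuHom]
  | add F G hF hG => simp_all
  | mul_X F i hF =>
    rw [map_mul, map_mul, hF]
    simp [nuHom, nu]

theorem GeneralPosition.nuHom_eq_zero (h : GeneralPosition f f')
    {b : Module.Basis (Fin 10) ℂ (septics f f')} {F : MvPolynomial (Fin 10) ℂ}
    (hF : ∀ x, eval x (facesForm f f') ≠ 0 → eval (nu b x) F = 0) : nuHom b F = 0 := by
  refine (mul_eq_zero.1 (?_ : facesForm f f' * _ = 0)).resolve_left h.facesForm_ne_zero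
  refine MvPolynomial.funext fun x => ?_
  rw [map_mul, eval_nuHom, map_zero, mul_eq_zero]
  exact or_iff_not_imp_left.2 (hF x)

theorem GeneralPosition.mem_homogeneousIdeal_fanoThreefold (h : GeneralPosition f f')
    {b : Module.Basis (Fin 10) ℂ (septics f f')} {F : MvPolynomial (Fin 10) ℂ} :
    F ∈ homogeneousIdeal (fanoThreefold b) ↔ nuHom b F = 0 := by
  rw [fanoThreefold, closedImage, homogeneousIdeal_zariskiClosure, mem_homogeneousIdeal]
  refine ⟨fun H => h.nuHom_eq_zero fun x hx => ?_, ?_⟩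
  · exact H _ (h.nu_ne_zero b hx) ⟨x, trivial, h.nu_ne_zero b hx, rfl⟩
  · rintro hF y hy ⟨x, -, hx, hxy⟩
    obtain ⟨c, rfl⟩ := (Projectivization.mk_eq_mk_iff' ℂ _ _ _ _).1 hxy
    -- A seventh root of the factor can be absorbed into `x`.
    obtain ⟨d, rfl⟩ := IsAlgClosed.exists_pow_nat_eq c (n := 7) (by norm_num)
    rw [← nu_smul, ← eval_nuHom, hF, map_zero]

theorem GeneralPosition.homogeneousIdeal_fanoThreefold (h : GeneralPosition f f')
    (b : Module.Basis (Fin 10) ℂ (septics f f')) :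
    homogeneousIdeal (fanoThreefold b) = RingHom.ker (nuHom b) := by
  ext F
  rw [h.mem_homogeneousIdeal_fanoThreefold, RingHom.mem_ker]

theorem GeneralPosition.facesForm_mul_X_algebraicIndependent (h : GeneralPosition f f') :
    AlgebraicIndependent ℂ fun i => facesForm f f' * X i := by
  rw [algebraicIndependent_iff]
  intro P hP
  refine (mul_eq_zero.1 (?_ : facesForm f f' * _ = 0)).resolve_left h.facesForm_ne_zero
  refine MvPolynomial.funext fun x => ?_
  rw [map_mul, map_zero, mul_eq_zero]
  refine or_iff_not_imp_left.2 fun hx => ?_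
  obtain ⟨d, hd⟩ := IsAlgClosed.exists_pow_nat_eq (eval x (facesForm f f'))⁻¹ (n := 7)
    (by norm_num)
  have h1 : aeval (fun i => eval (d • x) (facesForm f f' * X i)) P = 0 := by
    have h2 := congrArg (aeval (R := ℂ) (d • x)) hP
    rw [map_zero] at h2
    rw [← h2]
    exact (comp_aeval_apply _ (aeval (R := ℂ) (d • x)) P).symm
  rw [aeval_eq_eval] at h1
  convert! h1 using 3
  ext i
  rw [map_mul, eval_X, eval_smul_of_isHomogeneous isHomogeneous_facesForm]
  have : x i = d ^ 7 * eval x (facesForm f f') * x i := by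
    rw [hd, inv_mul_cancel₀ hx, one_mul]
  rw [this, Pi.smul_apply, smul_eq_mul]
  ring

/-- The image of the rational map has dimension three. -/
theorem GeneralPosition.ringKrullDim_fanoThreefold (h : GeneralPosition f f')
    (b : Module.Basis (Fin 10) ℂ (septics f f')) :
    ringKrullDim (MvPolynomial (Fin 10) ℂ ⧸ homogeneousIdeal (fanoThreefold b)) = 4 := by
  rw [h.homogeneousIdeal_fanoThreefold]
  have hinj := Ideal.kerLiftAlg_injective (nuHom b)
  have : IsDomain (MvPolynomial (Fin 10) ℂ ⧸ RingHom.ker (nuHom b)) :=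
    hinj.isDomain (Ideal.kerLiftAlg (nuHom b)).toRingHom
  have hz : AlgebraicIndependent ℂ fun i : Fin 4 => Ideal.Quotient.mkₐ ℂ (RingHom.ker (nuHom b))
      (linForm (LinearMap.proj i ∘ₗ LinearMap.fst ℂ _ _ ∘ₗ (h.coords b).toLinearMap)) := by
    refine ((Ideal.kerLiftAlg (nuHom b)).algebraicIndependent_iff hinj).1 ?_
    convert! h.facesForm_mul_X_algebraicIndependent using 1
    ext1 i
    rw [Function.comp_apply, Ideal.Quotient.mkₐ_eq_mk, Ideal.kerLiftAlg_mk]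
    refine MvPolynomial.funext fun x => ?_
    rw [eval_nuHom, eval_linForm, map_mul, eval_X]
    simp [h.coords_nu]
  exact_mod_cast ringKrullDim_eq_of_algebraicIndependent (Ideal.kerLiftAlg (nuHom b)) hinj hz

/-! ### Equations of the image -/

theorem GeneralPosition.quadric (h : GeneralPosition f f')
    (b : Module.Basis (Fin 10) ℂ (septics f f'))
    {A B M N : Module.Dual ℂ ((Fin 4 → ℂ) × (Fin 3 ⊕ Fin 3 → ℂ))}
    (hq : ∀ x, (∀ k, face f f' k x ≠ 0) →
      A (x, ratio f f' x) * B (x, ratio f f' x) = M (x, ratio f f' x) * N (x, ratio f f' x))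
    {p : PSpace 10} (hp : p ∈ fanoThreefold b) :
    A (h.coords b p.rep) * B (h.coords b p.rep) = M (h.coords b p.rep) * N (h.coords b p.rep) ∧
    ∀ w ∈ coneTangentSpace (fanoThreefold b) p,
      A (h.coords b w) * B (h.coords b p.rep) + A (h.coords b p.rep) * B (h.coords b w) =
      M (h.coords b w) * N (h.coords b p.rep) + M (h.coords b p.rep) * N (h.coords b w) := by
  have hF : linForm (A ∘ₗ (h.coords b).toLinearMap) * linForm (B ∘ₗ (h.coords b).toLinearMap) -
      linForm (M ∘ₗ (h.coords b).toLinearMap) * linForm (N ∘ₗ (h.coords b).toLinearMap) ∈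
      homogeneousIdeal (fanoThreefold b) := by
    refine h.mem_homogeneousIdeal_fanoThreefold.2 (h.nuHom_eq_zero fun x hx => ?_)
    simp only [map_sub, map_mul, eval_linForm, LinearMap.comp_apply, LinearEquiv.coe_coe,
      h.coords_nu_eq_smul b hx, map_smul, smul_eq_mul]
    linear_combination eval x (facesForm f f') ^ 2 * hq x (faces_ne_zero hx)
  constructor
  · rw [← p.mk_rep] at hp
    have := mem_homogeneousIdeal.1 hF _ p.rep_nonzero hp
    simpa [sub_eq_zero] using this
  · intro w hw
    have : dirDeriv _ p.rep w = 0 := hw _ hF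
    rw [dirDeriv_sub, dirDeriv_mul, dirDeriv_mul, sub_eq_zero] at this
    simpa using this

theorem mate₁_mate₁ (k : Fin 3 ⊕ Fin 3) : mate₁ (mate₁ k) = mate₂ k := by revert k; decide

theorem mate₁_mate₂ (k : Fin 3 ⊕ Fin 3) : mate₁ (mate₂ k) = k := by revert k; decide

theorem mate₂_mate₁ (k : Fin 3 ⊕ Fin 3) : mate₂ (mate₁ k) = k := by revert k; decide

theorem mate₂_mate₂ (k : Fin 3 ⊕ Fin 3) : mate₂ (mate₂ k) = mate₁ k := by revert k; decide

variable (h : GeneralPosition f f') (b : Module.Basis (Fin 10) ℂ (septics f f'))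
  {p : PSpace 10}

theorem GeneralPosition.ratio_mate_quadric (hp : p ∈ fanoThreefold b) (k : Fin 3 ⊕ Fin 3) :
    (h.coords b p.rep).2 (mate₁ k) * (h.coords b p.rep).2 (mate₂ k) =
      face f f' k (h.coords b p.rep).1 * face f f' k (h.coords b p.rep).1 ∧
    ∀ w ∈ coneTangentSpace (fanoThreefold b) p,
      (h.coords b w).2 (mate₁ k) * (h.coords b p.rep).2 (mate₂ k) +
        (h.coords b p.rep).2 (mate₁ k) * (h.coords b w).2 (mate₂ k) =
      face f f' k (h.coords b w).1 * face f f' k (h.coords b p.rep).1 +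
        face f f' k (h.coords b p.rep).1 * face f f' k (h.coords b w).1 :=
  h.quadric b (A := LinearMap.proj (mate₁ k) ∘ₗ LinearMap.snd ℂ _ _)
    (B := LinearMap.proj (mate₂ k) ∘ₗ LinearMap.snd ℂ _ _)
    (M := face f f' k ∘ₗ LinearMap.fst ℂ _ _) (N := face f f' k ∘ₗ LinearMap.fst ℂ _ _)
    (fun x hx => by
      have h1 := hx (mate₁ k)
      have h2 := hx (mate₂ k)
      simp only [LinearMap.comp_apply, LinearMap.snd_apply, LinearMap.fst_apply,
        LinearMap.proj_apply, ratio, mate₁_mate₁, mate₁_mate₂, mate₂_mate₁, mate₂_mate₂]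
      field_simp) hp

theorem GeneralPosition.ratio_face_quadric (hp : p ∈ fanoThreefold b) (k : Fin 3 ⊕ Fin 3) :
    (h.coords b p.rep).2 k * face f f' k (h.coords b p.rep).1 =
      face f f' (mate₁ k) (h.coords b p.rep).1 * face f f' (mate₂ k) (h.coords b p.rep).1 ∧
    ∀ w ∈ coneTangentSpace (fanoThreefold b) p,
      (h.coords b w).2 k * face f f' k (h.coords b p.rep).1 +
        (h.coords b p.rep).2 k * face f f' k (h.coords b w).1 =
      face f f' (mate₁ k) (h.coords b w).1 * face f f' (mate₂ k) (h.coords b p.rep).1 +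
        face f f' (mate₁ k) (h.coords b p.rep).1 * face f f' (mate₂ k) (h.coords b w).1 :=
  h.quadric b (A := LinearMap.proj k ∘ₗ LinearMap.snd ℂ _ _)
    (B := face f f' k ∘ₗ LinearMap.fst ℂ _ _)
    (M := face f f' (mate₁ k) ∘ₗ LinearMap.fst ℂ _ _)
    (N := face f f' (mate₂ k) ∘ₗ LinearMap.fst ℂ _ _)
    (fun x hx => by
      have h1 := hx k
      simp only [LinearMap.comp_apply, LinearMap.snd_apply, LinearMap.fst_apply,
        LinearMap.proj_apply, ratio]
      field_simp) hp

/-! ### Smooth points -/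

/-- At a point of the image where a coordinate of each of the two groups of `faceSeptic`s is
nonzero, the tangent space of the cone has dimension at most four. -/
theorem GeneralPosition.finrank_coneTangentSpace_le (hp : p ∈ fanoThreefold b)
    {k k' : Fin 3 ⊕ Fin 3} (hkk' : k.isLeft ≠ k'.isLeft)
    (hk : (h.coords b p.rep).2 k ≠ 0) (hk' : (h.coords b p.rep).2 k' ≠ 0) :
    Module.finrank ℂ (coneTangentSpace (fanoThreefold b) p) ≤ 4 := by
  have q1 := h.ratio_mate_quadric b hp
  have q2 := h.ratio_face_quadric b hp
  set z := h.coords b p.rep with hz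
  -- The map `Λ` embeds the tangent space into the kernel of `Φ`, which is given by two independent
  -- linear forms on a space of dimension six.
  let ψ : Fin 3 ⊕ Fin 3 → Module.Dual ℂ (Fin 4 → ℂ) := fun m =>
    z.2 m • face f f' m - face f f' (mate₂ m) z.1 • face f f' (mate₁ m) -
      face f f' (mate₁ m) z.1 • face f f' (mate₂ m)
  let Φ : (Fin 4 → ℂ) × ℂ × ℂ →ₗ[ℂ] ℂ × ℂ :=
    LinearMap.prod
      (ψ k ∘ₗ LinearMap.fst ℂ _ _ +
        face f f' k z.1 • (LinearMap.fst ℂ ℂ ℂ ∘ₗ LinearMap.snd ℂ _ _))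
      (ψ k' ∘ₗ LinearMap.fst ℂ _ _ +
        face f f' k' z.1 • (LinearMap.snd ℂ ℂ ℂ ∘ₗ LinearMap.snd ℂ _ _))
  let Λ : (Fin 10 → ℂ) →ₗ[ℂ] (Fin 4 → ℂ) × ℂ × ℂ :=
    (LinearMap.prod (LinearMap.fst ℂ _ _) (LinearMap.prod
      (LinearMap.proj k ∘ₗ LinearMap.snd ℂ _ _) (LinearMap.proj k' ∘ₗ LinearMap.snd ℂ _ _))) ∘ₗ
      (h.coords b).toLinearMap
  have hΛ : ∀ w ∈ coneTangentSpace (fanoThreefold b) p, Λ w ∈ LinearMap.ker Φ := by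
    intro w hw
    rw [LinearMap.mem_ker]
    refine Prod.ext ?_ ?_
    · have := (q2 k).2 w hw
      simp [Φ, Λ, ψ]
      linear_combination this
    · have := (q2 k').2 w hw
      simp [Φ, Λ, ψ]
      linear_combination this
  have hinj : ∀ w ∈ coneTangentSpace (fanoThreefold b) p, Λ w = 0 → w = 0 := by
    intro w hw h0
    have e1 : (h.coords b w).1 = 0 := congrArg Prod.fst h0
    have e2 : (h.coords b w).2 k = 0 := congrArg (fun u => u.2.1) h0
    have e3 : (h.coords b w).2 k' = 0 := congrArg (fun u => u.2.2) h0
    have key : ∀ m, z.2 m ≠ 0 → (h.coords b w).2 m = 0 →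
        (h.coords b w).2 (mate₁ m) = 0 ∧ (h.coords b w).2 (mate₂ m) = 0 := by
      intro m hm h1
      have a1 := (q1 (mate₂ m)).2 w hw
      have a2 := (q1 (mate₁ m)).2 w hw
      rw [mate₁_mate₂, mate₂_mate₂, e1, h1, map_zero, zero_mul, zero_add, zero_mul, mul_zero,
        add_zero] at a1
      rw [mate₁_mate₁, mate₂_mate₁, e1, h1, map_zero, zero_mul, mul_zero, add_zero, zero_add,
        mul_zero] at a2
      exact ⟨(mul_eq_zero.1 a1).resolve_left hm, (mul_eq_zero.1 a2).resolve_right hm⟩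
    have hall : ∀ m, m = k ∨ m = mate₁ k ∨ m = mate₂ k ∨ m = k' ∨ m = mate₁ k' ∨
        m = mate₂ k' := by
      clear * - hkk'; revert k k'; decide
    apply (h.coords b).injective
    rw [map_zero]
    refine Prod.ext e1 (funext fun m => ?_)
    rcases hall m with rfl | rfl | rfl | rfl | rfl | rfl
    · exact e2
    · exact (key k hk e2).1
    · exact (key k hk e2).2
    · exact e3
    · exact (key k' hk' e3).1
    · exact (key k' hk' e3).2
  have hψ : ∀ m, z.2 m ≠ 0 → face f f' m z.1 ≠ 0 ∨ ∃ n, (n = mate₁ m ∨ n = mate₂ m) ∧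
      ∀ η, face f f' n η = 0 → ψ m η = z.2 m * face f f' m η := by
    intro m hm
    refine or_iff_not_imp_left.2 fun h0 => ?_
    have := (q2 m).1
    rw [not_not.1 h0, mul_zero] at this
    rcases mul_eq_zero.1 this.symm with h1 | h1
    · exact ⟨mate₁ m, Or.inl rfl, fun η hη => by simp [ψ, h1, hη]⟩
    · exact ⟨mate₂ m, Or.inr rfl, fun η hη => by simp [ψ, h1, hη]⟩
  have hsurj : Function.Surjective Φ := by
    have hΦ : ∀ η r r', Φ (η, r, r') = (ψ k η + face f f' k z.1 * r,
        ψ k' η + face f f' k' z.1 * r') := fun η r r' => rfl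
    rintro ⟨a, a'⟩
    rcases hψ k hk with h1 | ⟨n, hn, h1⟩ <;> rcases hψ k' hk' with h1' | ⟨n', hn', h1'⟩
    · refine ⟨(0, a / face f f' k z.1, a' / face f f' k' z.1), ?_⟩
      rw [hΦ, map_zero, map_zero, zero_add, zero_add, mul_div_cancel₀ _ h1, mul_div_cancel₀ _ h1']
    · have he : Function.Injective ![k', n', k, mate₁ k] := by
        clear * - hkk' hn'; revert k k' n'; decide
      obtain ⟨η, hη⟩ := h.exists_point he ![a' / z.2 k', 0, 0, 0]
      refine ⟨(η, (a - ψ k η) / face f f' k z.1, 0), ?_⟩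
      have hη0 : face f f' k' η = a' / z.2 k' := hη 0
      rw [hΦ, h1' η (hη 1), mul_div_cancel₀ _ h1, hη0, mul_div_cancel₀ _ hk']
      simp
    · have he : Function.Injective ![k, n, k', mate₁ k'] := by
        clear * - hkk' hn; revert k k' n; decide
      obtain ⟨η, hη⟩ := h.exists_point he ![a / z.2 k, 0, 0, 0]
      refine ⟨(η, 0, (a' - ψ k' η) / face f f' k' z.1), ?_⟩
      have hη0 : face f f' k η = a / z.2 k := hη 0
      rw [hΦ, h1 η (hη 1), mul_div_cancel₀ _ h1', hη0, mul_div_cancel₀ _ hk]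
      simp
    · have he : Function.Injective ![k, n, k', n'] := by
        clear * - hkk' hn hn'; revert k k' n n'; decide
      obtain ⟨η, hη⟩ := h.exists_point he ![a / z.2 k, 0, a' / z.2 k', 0]
      refine ⟨(η, 0, 0), ?_⟩
      have hη0 : face f f' k η = a / z.2 k := hη 0
      have hη2 : face f f' k' η = a' / z.2 k' := hη 2
      rw [hΦ, h1 η (hη 1), h1' η (hη 3), hη0, hη2, mul_div_cancel₀ _ hk, mul_div_cancel₀ _ hk']
      simp
  have hker : Module.finrank ℂ (LinearMap.ker Φ) = 4 := by
    have h1 := LinearMap.finrank_range_add_finrank_ker Φ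
    rw [LinearMap.range_eq_top.2 hsurj, finrank_top] at h1
    simp only [Module.finrank_prod, Module.finrank_fin_fun, Module.finrank_self] at h1
    omega
  rw [← hker]
  let L : coneTangentSpace (fanoThreefold b) p →ₗ[ℂ] LinearMap.ker Φ :=
    (Λ ∘ₗ (coneTangentSpace (fanoThreefold b) p).subtype).codRestrict _ fun w => hΛ w w.2
  refine LinearMap.finrank_le_finrank_of_injective (f := L) ?_
  rw [injective_iff_map_eq_zero]
  intro w hw
  exact Subtype.ext (hinj w w.2 (congrArg Subtype.val hw))

end Image

section Nodes

variable {f f' : Fin 3 → Module.Dual ℂ (Fin 4 → ℂ)}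

/-! ### The eight nodes -/

variable (f f') in
/-- The eight vectors, in the coordinates `GeneralPosition.coords`, of the singular points of the
image, for vectors `v`, `v'` of coordinates of the vertices of the two trihedra. They come in two
groups of four. The vectors `(v, ratio f f' v)` and `(v', ratio f f' v')` are limits of vectors
`(x, ratio f f' x)`: the ratios that are not defined at the vertex tend to zero along general
arcs, in agreement with the convention for the division by zero. -/
noncomputable def node (v v' : Fin 4 → ℂ) :
    Option (Fin 3) ⊕ Option (Fin 3) → (Fin 4 → ℂ) × (Fin 3 ⊕ Fin 3 → ℂ) :=
  Sum.elim
    (fun m => m.elim (v', ratio f f' v') fun i => (0, Pi.single (Sum.inl i) 1))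
    (fun m => m.elim (v, ratio f f' v) fun i => (0, Pi.single (Sum.inr i) 1))

/-- The group of four nodes that does not contain the node `n`. -/
def across (n : Option (Fin 3) ⊕ Option (Fin 3)) :
    Option (Fin 3) → Option (Fin 3) ⊕ Option (Fin 3) :=
  Sum.elim (fun _ => Sum.inr) (fun _ => Sum.inl) n

theorem GeneralPosition.exists_vertex (h : GeneralPosition f f') (k : Fin 3 ⊕ Fin 3) :
    ∃ v, v ≠ 0 ∧ ∀ i, face f f' (opposite k i) v = 0 := by
  have he : Function.Injective ![opposite k 0, opposite k 1, opposite k 2, k] := by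
    clear * -; revert k; decide
  obtain ⟨v, hv⟩ := h.exists_point he ![0, 0, 0, 1]
  refine ⟨v, fun h0 => ?_, fun i => ?_⟩
  · have := hv 3
    rw [h0, map_zero] at this
    simp at this
  · fin_cases i
    · exact hv 0
    · exact hv 1
    · exact hv 2

theorem GeneralPosition.face_vertex_ne_zero (h : GeneralPosition f f') {k : Fin 3 ⊕ Fin 3}
    {v : Fin 4 → ℂ} (hv0 : v ≠ 0) (hv : ∀ i, face f f' (opposite k i) v = 0) :
    face f f' k v ≠ 0 := by
  have he : Function.Injective ![opposite k 0, opposite k 1, opposite k 2, k] := by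
    clear * -; revert k; decide
  refine fun h0 => hv0 (h.eq_zero he fun i => ?_)
  fin_cases i
  · exact hv 0
  · exact hv 1
  · exact hv 2
  · exact h0

theorem GeneralPosition.eq_smul_vertex (h : GeneralPosition f f') (k : Fin 3 ⊕ Fin 3)
    {v x : Fin 4 → ℂ} (hv0 : v ≠ 0) (hv : ∀ i, face f f' (opposite k i) v = 0)
    (hx : ∀ i, face f f' (opposite k i) x = 0) : x = (face f f' k x / face f f' k v) • v := by
  have hk := h.face_vertex_ne_zero hv0 hv
  rw [← sub_eq_zero]
  by_contra hne
  refine h.face_vertex_ne_zero hne (k := k) (fun i => ?_) ?_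
  · simp [hv, hx]
  · simp [hk]

theorem ratio_smul (c : ℂ) (x : Fin 4 → ℂ) : ratio f f' (c • x) = c • ratio f f' x := by
  ext k
  simp only [ratio, map_smul, smul_eq_mul, Pi.smul_apply]
  rcases eq_or_ne c 0 with rfl | hc
  · simp
  rcases eq_or_ne (face f f' k x) 0 with hk | hk
  · simp [hk]
  field_simp

theorem ratio_eq_zero {k : Fin 3 ⊕ Fin 3} {v : Fin 4 → ℂ}
    (hv : ∀ i, face f f' (opposite k i) v = 0) (i : Fin 3) : ratio f f' v (opposite k i) = 0 := by
  obtain ⟨j, hj⟩ : ∃ j, mate₁ (opposite k i) = opposite k j := by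
    clear * -; revert k i; decide
  rw [ratio, hj, hv, zero_mul, zero_div]

variable {v v' : Fin 4 → ℂ}

theorem GeneralPosition.linearIndependent_node (h : GeneralPosition f f')
    (hv0 : v ≠ 0) (hv : ∀ i, f i v = 0) (hv0' : v' ≠ 0) (hv' : ∀ i, f' i v' = 0) :
    LinearIndependent ℂ (node f f' v v') := by
  refine Fintype.linearIndependent_iff.2 fun c hc => ?_
  have e1 : c (Sum.inl none) • v' + c (Sum.inr none) • v = 0 := by
    have := congrArg Prod.fst hc
    simpa [Fintype.sum_option, node, Prod.fst_sum] using this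
  have a1 : c (Sum.inl none) = 0 := by
    have h1 := congrArg (f 0) e1
    rw [map_add, map_smul, map_smul, hv 0, smul_zero, add_zero, map_zero, smul_eq_mul] at h1
    exact (mul_eq_zero.1 h1).resolve_right
      (h.face_vertex_ne_zero (k := Sum.inl 0) hv0' hv')
  have a2 : c (Sum.inr none) = 0 := by
    have h1 := congrArg (f' 0) e1
    rw [map_add, map_smul, map_smul, hv' 0, smul_zero, zero_add, map_zero, smul_eq_mul] at h1
    exact (mul_eq_zero.1 h1).resolve_right
      (h.face_vertex_ne_zero (k := Sum.inr 0) hv0 hv)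
  have e2 : ∀ k, (∑ i, c (Sum.inl (some i)) * Pi.single (M := fun _ => ℂ) (Sum.inl i) 1 k) +
      ∑ i, c (Sum.inr (some i)) * Pi.single (M := fun _ => ℂ) (Sum.inr i) 1 k = 0 := by
    intro k
    have := congrFun (congrArg Prod.snd hc) k
    rw [Fintype.sum_sum_type, Fintype.sum_option, Fintype.sum_option, a1, a2] at this
    simpa [node, Prod.snd_sum, Finset.sum_apply] using this
  rintro ((_ | i) | (_ | i))
  · exact a1
  · simpa [Pi.single_apply] using e2 (Sum.inl i)
  · exact a2
  · simpa [Pi.single_apply] using e2 (Sum.inr i)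

/-- A point of the image at which the coordinates attached to the trihedron that does not contain
the face `k` vanish is one of four nodes: the three attached to the faces of the trihedron of `k`,
and the one attached to the vertex of the other trihedron. -/
theorem GeneralPosition.coords_rep_eq (h : GeneralPosition f f')
    (b : Module.Basis (Fin 10) ℂ (septics f f')) {p : PSpace 10} (hp : p ∈ fanoThreefold b)
    {k : Fin 3 ⊕ Fin 3} (hs : ∀ i, (h.coords b p.rep).2 (opposite k i) = 0)
    {v : Fin 4 → ℂ} (hv0 : v ≠ 0) (hv : ∀ i, face f f' (opposite k i) v = 0) :
    (∃ (m : Fin 3 ⊕ Fin 3) (c : ℂ), m.isLeft = k.isLeft ∧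
      h.coords b p.rep = c • (0, Pi.single m 1)) ∨
      ∃ c : ℂ, h.coords b p.rep = c • (v, ratio f f' v) := by
  have q1 := fun m => (h.ratio_mate_quadric b hp m).1
  have q2 := fun m => (h.ratio_face_quadric b hp m).1
  have hz0 : h.coords b p.rep ≠ 0 := by simpa using p.rep_nonzero
  generalize h.coords b p.rep = z at *
  obtain ⟨ξ, s⟩ := z
  simp only at q1 q2 hs
  have hξ : ∀ i, face f f' (opposite k i) ξ = 0 := by
    intro i
    obtain ⟨j, hj⟩ : ∃ j, mate₁ (opposite k i) = opposite k j := by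
      clear * -; revert k i; decide
    have := q1 (opposite k i)
    rw [hj, hs, zero_mul] at this
    exact mul_self_eq_zero.1 this.symm
  rcases eq_or_ne ξ 0 with h0 | h0
  · left
    simp only [h0, map_zero, mul_zero] at q1
    have hex : ∃ m, s m ≠ 0 := by
      by_contra! H
      exact hz0 (Prod.ext h0 (funext H))
    obtain ⟨m, hm⟩ := hex
    have hmk : m.isLeft = k.isLeft := by
      have : ¬ ∃ i, m = opposite k i := fun ⟨i, hi⟩ => hm (hi ▸ hs i)
      clear * - this; revert k m; decide
    refine ⟨m, s m, hmk, Prod.ext (by simpa using h0) (funext fun j => ?_)⟩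
    have hj : j = m ∨ (∃ i, j = opposite k i) ∨ j = mate₁ m ∨ j = mate₂ m := by
      clear * - hmk; revert k m j; decide
    rcases hj with rfl | ⟨i, rfl⟩ | rfl | rfl
    · simp
    · have hne : opposite k i ≠ m := by
        clear * - hmk; revert k m i; decide
      simp [hs, hne]
    · have := q1 (mate₂ m)
      rw [mate₁_mate₂, mate₂_mate₂] at this
      have hne : mate₁ m ≠ m := by clear * -; revert m; decide
      simpa [hne] using (mul_eq_zero.1 this).resolve_left hm
    · have := q1 (mate₁ m)
      rw [mate₁_mate₁, mate₂_mate₁] at this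
      have hne : mate₂ m ≠ m := by clear * -; revert m; decide
      simpa [hne] using (mul_eq_zero.1 this).resolve_right hm
  · right
    have hc := h.eq_smul_vertex k hv0 hv hξ
    refine ⟨_, Prod.ext hc ?_⟩
    rw [Prod.smul_snd, ← ratio_smul, ← hc]
    ext m
    by_cases hm : ∃ i, m = opposite k i
    · obtain ⟨i, rfl⟩ := hm
      exact (hs i).trans (ratio_eq_zero hξ i).symm
    · have hkm : ∀ i, face f f' (opposite m i) ξ = 0 := by
        have : opposite m = opposite k := by
          funext i; clear * - hm; revert k m i; decide
        rwa [this]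
      have := h.face_vertex_ne_zero h0 hkm
      rw [ratio, eq_div_iff this]
      exact q2 m

/-- The point of `ℙ⁹` with given nonzero adapted coordinates. -/
noncomputable def GeneralPosition.point (h : GeneralPosition f f')
    (b : Module.Basis (Fin 10) ℂ (septics f f')) (y : (Fin 4 → ℂ) × (Fin 3 ⊕ Fin 3 → ℂ))
    (hy : y ≠ 0) : PSpace 10 :=
  Projectivization.mk ℂ ((h.coords b).symm y) (by simpa using hy)

theorem GeneralPosition.eq_point (h : GeneralPosition f f')
    (b : Module.Basis (Fin 10) ℂ (septics f f')) {p : PSpace 10}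
    {y : (Fin 4 → ℂ) × (Fin 3 ⊕ Fin 3 → ℂ)} (hy : y ≠ 0) {c : ℂ}
    (hc : h.coords b p.rep = c • y) : p = h.point b y hy := by
  rw [← p.mk_rep, point]
  refine (Projectivization.mk_eq_mk_iff' ℂ _ _ _ _).2 ⟨c, ?_⟩
  rw [← map_smul, ← hc, LinearEquiv.symm_apply_apply]

theorem GeneralPosition.exists_smul_eq_of_point_eq (h : GeneralPosition f f')
    (b : Module.Basis (Fin 10) ℂ (septics f f')) {y z : (Fin 4 → ℂ) × (Fin 3 ⊕ Fin 3 → ℂ)}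
    {hy : y ≠ 0} {hz : z ≠ 0} (hyz : h.point b y hy = h.point b z hz) : ∃ c : ℂ, c • z = y := by
  obtain ⟨c, hc⟩ := (Projectivization.mk_eq_mk_iff' ℂ _ _ _ _).1 hyz
  refine ⟨c, ?_⟩
  rwa [← map_smul, (h.coords b).symm.injective.eq_iff] at hc

theorem GeneralPosition.eq_of_point_node_eq (h : GeneralPosition f f')
    (b : Module.Basis (Fin 10) ℂ (septics f f')) (hv0 : v ≠ 0) (hv : ∀ i, f i v = 0)
    (hv0' : v' ≠ 0) (hv' : ∀ i, f' i v' = 0) {n n' : Option (Fin 3) ⊕ Option (Fin 3)}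
    {hn : node f f' v v' n ≠ 0} {hn' : node f f' v v' n' ≠ 0}
    (hnn' : h.point b _ hn = h.point b _ hn') : n = n' := by
  obtain ⟨c, hc⟩ := h.exists_smul_eq_of_point_eq b hnn'
  have hLI := h.linearIndependent_node hv0 hv hv0' hv'
  by_contra hne
  refine hLI.notMem_span_image (s := {n'}) (x := n) (by simpa using hne) ?_
  rw [Set.image_singleton, Submodule.mem_span_singleton]
  exact ⟨c, hc⟩

/-- The singular points of the image are among the eight nodes. -/
theorem GeneralPosition.eq_node_of_isSingularPoint (h : GeneralPosition f f')
    (b : Module.Basis (Fin 10) ℂ (septics f f'))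
    (hv0 : v ≠ 0) (hv : ∀ i, f i v = 0) (hv0' : v' ≠ 0) (hv' : ∀ i, f' i v' = 0)
    {p : PSpace 10} (hp : IsSingularPoint (fanoThreefold b) p) :
    ∃ n, ∃ c : ℂ, h.coords b p.rep = c • node f f' v v' n := by
  by_cases h1 : ∀ i, (h.coords b p.rep).2 (Sum.inl i) = 0
  · rcases h.coords_rep_eq b hp.1 (k := Sum.inr 0) h1 hv0 hv with ⟨m, c, hm, hc⟩ | ⟨c, hc⟩
    · obtain ⟨i, rfl⟩ : ∃ i, m = Sum.inr i := by
        clear hc; revert m; decide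
      exact ⟨Sum.inr (some i), c, hc⟩
    · exact ⟨Sum.inr none, c, hc⟩
  by_cases h2 : ∀ i, (h.coords b p.rep).2 (Sum.inr i) = 0
  · rcases h.coords_rep_eq b hp.1 (k := Sum.inl 0) h2 hv0' hv' with ⟨m, c, hm, hc⟩ | ⟨c, hc⟩
    · obtain ⟨i, rfl⟩ : ∃ i, m = Sum.inl i := by
        clear hc; revert m; decide
      exact ⟨Sum.inl (some i), c, hc⟩
    · exact ⟨Sum.inl none, c, hc⟩
  push Not at h1 h2
  obtain ⟨i, hi⟩ := h1
  obtain ⟨j, hj⟩ := h2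
  have h4 := h.finrank_coneTangentSpace_le b hp.1 (k := Sum.inl i) (k' := Sum.inr j) (by simp)
    hi hj
  have h5 := hp.2
  rw [h.ringKrullDim_fanoThreefold] at h5
  have h6 : 4 < Module.finrank ℂ (coneTangentSpace (fanoThreefold b) p) := by exact_mod_cast h5
  omega

/-! ### The lines as images of exceptional divisors -/

theorem exists_eq_smul_of_tendsto {V : Type*} [NormedAddCommGroup V] [NormedSpace ℂ V]
    [FiniteDimensional ℂ V] {l : Filter ℂ} [l.NeBot] {y : ℂ → V} {a : ℂ → ℂ} {L M : V}
    (hL : L ≠ 0) (hy : Filter.Tendsto y l (𝓝 L))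
    (ha : Filter.Tendsto (fun t => a t • y t) l (𝓝 M)) : ∃ r : ℂ, M = r • L := by
  obtain ⟨φ, hφ⟩ : ∃ φ : Module.Dual ℂ V, φ L ≠ 0 := by
    by_contra! H
    exact hL ((Module.forall_dual_apply_eq_zero_iff ℂ L).1 H)
  have hc : Continuous φ := φ.continuous_of_finiteDimensional
  have h1 : Filter.Tendsto (fun t => φ (y t)) l (𝓝 (φ L)) := (hc.tendsto _).comp hy
  have h2 : Filter.Tendsto (fun t => φ (a t • y t)) l (𝓝 (φ M)) := (hc.tendsto _).comp ha
  have h3 : Filter.Tendsto a l (𝓝 (φ M / φ L)) := by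
    refine (h2.div h1 hφ).congr' ?_
    filter_upwards [h1.eventually_ne hφ] with t ht
    simp [ht]
  exact ⟨_, tendsto_nhds_unique ha (h3.smul hy)⟩

/-- The arcs that are used for the exceptional divisor over the point `g₁ = g₂ = g₃ = 0`. -/
def IsArc (g₁ g₂ g₃ : Module.Dual ℂ (Fin 4 → ℂ)) (α β γ : ℂ) (x : ℂ → Fin 4 → ℂ) : Prop :=
  Continuous x ∧ x 0 ≠ 0 ∧ ∀ t, g₁ (x t) = α * t ^ 2 ∧ g₂ (x t) = β * t ∧ g₃ (x t) = γ * t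

/-- If the images of all arcs, rescaled by `ε`, tend to the vectors `S • P + T • Q`, and all values
of `S` and `T` occur, then the image of the exceptional divisor is the line joining `P` and `Q`. -/
theorem GeneralPosition.exceptionalImage_eq_joiningLine (h : GeneralPosition f f')
    (b : Module.Basis (Fin 10) ℂ (septics f f')) {k₁ k₂ k₃ k₄ : Fin 3 ⊕ Fin 3}
    (hk : Function.Injective ![k₁, k₂, k₃, k₄])
    {P Q : (Fin 4 → ℂ) × (Fin 3 ⊕ Fin 3 → ℂ)} (hP : P ≠ 0) (hQ : Q ≠ 0)
    (hPQ : LinearIndependent ℂ ![P, Q])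
    (S T : ℂ → ℂ → ℂ → (Fin 4 → ℂ) → ℂ) {ε : ℂ → ℂ} (hε : ∀ t, t ≠ 0 → ε t ≠ 0)
    (hlim : ∀ α β γ, α ≠ 0 → β ≠ 0 → γ ≠ 0 → ∀ x,
      IsArc (face f f' k₁) (face f f' k₂) (face f f' k₃) α β γ x →
      S α β γ (x 0) ≠ 0 ∧ (∀ᶠ t in 𝓝[≠] 0, eval (x t) (facesForm f f') ≠ 0) ∧
      Filter.Tendsto (fun t => ε t • (x t, ratio f f' (x t))) (𝓝[≠] 0)
        (𝓝 (S α β γ (x 0) • P + T α β γ (x 0) • Q)))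
    (hsol : ∀ s t, s ≠ 0 → t ≠ 0 → ∃ α β γ o, α ≠ 0 ∧ β ≠ 0 ∧ γ ≠ 0 ∧ o ≠ 0 ∧
      face f f' k₁ o = 0 ∧ face f f' k₂ o = 0 ∧ face f f' k₃ o = 0 ∧
      S α β γ o = s ∧ T α β γ o = t) :
    exceptionalImage b (face f f' k₁) (face f f' k₂) (face f f' k₃) =
      joiningLine (h.point b P hP) (h.point b Q hQ) := by
  have hcont : Continuous (h.coords b) :=
    (h.coords b).toLinearMap.continuous_of_finiteDimensional
  have hcont' : Continuous (h.coords b).symm :=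
    (h.coords b).symm.toLinearMap.continuous_of_finiteDimensional
  refine zariskiClosure_eq_joiningLine _ _ ?_ ?_ ?_
  · rintro p ⟨α, β, γ, hα, hβ, hγ, x, hx, hx0, hxt, c, hc⟩
    obtain ⟨hS, hD, hL⟩ := hlim α β γ hα hβ hγ x ⟨hx, hx0, hxt⟩
    have hne : S α β γ (x 0) • P + T α β γ (x 0) • Q ≠ 0 := fun h0 =>
      hS (LinearIndependent.pair_iff.1 hPQ _ _ h0).1
    have hM : Filter.Tendsto (fun t => (c t * eval (x t) (facesForm f f') / ε t) •
        (ε t • (x t, ratio f f' (x t)))) (𝓝[≠] 0) (𝓝 (h.coords b p.rep)) := by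
      refine ((hcont.tendsto _).comp hc).congr' ?_
      filter_upwards [hD, self_mem_nhdsWithin] with t ht ht0
      rw [Function.comp_apply, map_smul, h.coords_nu_eq_smul b ht, smul_smul, smul_smul,
        div_mul_cancel₀ _ (hε t ht0)]
    obtain ⟨r, hr⟩ := exists_eq_smul_of_tendsto hne hL hM
    rw [← p.mk_rep]
    refine (mk_mem_joiningLine _ _ p.rep_nonzero).2
      ⟨r * S α β γ (x 0), r * T α β γ (x 0), (h.coords b).injective ?_⟩
    simp only [map_add, map_smul, LinearEquiv.apply_symm_apply, hr, smul_add, smul_smul]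
  · intro s t hs ht hst
    obtain ⟨α, β, γ, o, hα, hβ, hγ, ho, h1, h2, h3, rfl, rfl⟩ := hsol s t hs ht
    obtain ⟨e₁, he₁⟩ := h.exists_point hk ![1, 0, 0, 0]
    obtain ⟨e₂, he₂⟩ := h.exists_point hk ![0, 1, 0, 0]
    obtain ⟨e₃, he₃⟩ := h.exists_point hk ![0, 0, 1, 0]
    let x : ℂ → Fin 4 → ℂ := fun t => o + (α * t ^ 2) • e₁ + (β * t) • e₂ + (γ * t) • e₃
    have hx : Continuous x := by fun_prop
    have hx0 : x 0 = o := by simp [x]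
    have hxt : ∀ t, face f f' k₁ (x t) = α * t ^ 2 ∧ face f f' k₂ (x t) = β * t ∧
        face f f' k₃ (x t) = γ * t := by
      intro t
      have a1 : face f f' k₁ e₁ = 1 ∧ face f f' k₂ e₁ = 0 ∧ face f f' k₃ e₁ = 0 :=
        ⟨he₁ 0, he₁ 1, he₁ 2⟩
      have a2 : face f f' k₁ e₂ = 0 ∧ face f f' k₂ e₂ = 1 ∧ face f f' k₃ e₂ = 0 :=
        ⟨he₂ 0, he₂ 1, he₂ 2⟩
      have a3 : face f f' k₁ e₃ = 0 ∧ face f f' k₂ e₃ = 0 ∧ face f f' k₃ e₃ = 1 :=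
        ⟨he₃ 0, he₃ 1, he₃ 2⟩
      simp [x, h1, h2, h3, a1, a2, a3]
    have hx0' : x 0 ≠ 0 := by rwa [hx0]
    obtain ⟨-, hD, hL⟩ := hlim α β γ hα hβ hγ x ⟨hx, hx0', hxt⟩
    rw [hx0] at hL
    obtain ⟨a, ha⟩ := Projectivization.exists_smul_eq_mk_rep ℂ _ hst
    refine ⟨α, β, γ, hα, hβ, hγ, x, hx, hx0', hxt,
      fun t => a * (ε t / eval (x t) (facesForm f f')), ?_⟩
    rw [← ha]
    have hlim' := ((hcont'.tendsto _).comp hL).const_smul (a : ℂ)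
    rw [map_add, map_smul, map_smul] at hlim'
    refine hlim'.congr' ?_
    filter_upwards [hD] with t ht
    rw [Function.comp_apply, mul_smul]
    congr 1
    rw [LinearEquiv.symm_apply_eq, map_smul, h.coords_nu_eq_smul b ht, smul_smul,
      div_mul_cancel₀ _ ht]
  · have := hPQ.map' (h.coords b).symm.toLinearMap (LinearEquiv.ker _)
    convert! this using 1
    ext i
    fin_cases i <;> rfl

/-- The exceptional divisor over the vertex of a trihedron. -/
theorem GeneralPosition.exceptionalImage_vertex (h : GeneralPosition f f')
    (b : Module.Basis (Fin 10) ℂ (septics f f')) {k k' : Fin 3 ⊕ Fin 3}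
    (hkk' : k.isLeft ≠ k'.isLeft) {v : Fin 4 → ℂ} (hv0 : v ≠ 0)
    (hv : ∀ i, face f f' (opposite k' i) v = 0) (hP hQ) :
    exceptionalImage b (face f f' k) (face f f' (mate₁ k)) (face f f' (mate₂ k)) =
      joiningLine (h.point b (0, Pi.single k 1) hP) (h.point b (v, ratio f f' v) hQ) := by
  have hvk' := h.face_vertex_ne_zero hv0 hv
  have hopp : ∀ m, (m = k ∨ m = mate₁ k ∨ m = mate₂ k) ∨ ∀ i, opposite m i = opposite k' i := by
    clear * - hkk'; revert k k'; decide
  have hoppk : ∀ i, opposite k' i = k ∨ opposite k' i = mate₁ k ∨ opposite k' i = mate₂ k := by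
    clear * - hkk'; revert k k'; decide
  have hmem : ∀ m, (m = k ∨ m = mate₁ k ∨ m = mate₂ k) → ∃ i, m = opposite k' i := by
    clear * - hkk'; revert k k'; decide
  have hinj : Function.Injective ![k, mate₁ k, mate₂ k, k'] := by
    clear * - hkk'; revert k k'; decide
  have hne1 : mate₁ k ≠ k := by clear * -; revert k; decide
  have hne2 : mate₂ k ≠ k := by clear * -; revert k; decide
  have hLI : LinearIndependent ℂ
      ![((0, Pi.single k 1) : (Fin 4 → ℂ) × (Fin 3 ⊕ Fin 3 → ℂ)), (v, ratio f f' v)] := by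
    refine LinearIndependent.pair_iff.2 fun s t hst => ?_
    have ht : t = 0 := by
      have := congrArg Prod.fst hst
      simpa [hv0] using this
    have := congrFun (congrArg Prod.snd hst) k
    simp [ht] at this
    exact ⟨this, ht⟩
  refine h.exceptionalImage_eq_joiningLine b hinj hP hQ hLI
    (fun α β γ _ => β * γ / α) (fun _ _ _ o => face f f' k' o / face f f' k' v)
    (ε := fun _ => 1) (fun _ _ => one_ne_zero) ?_ ?_
  · rintro α β γ hα hβ hγ x ⟨hx, hx0, hxt⟩
    have hx0v : ∀ i, face f f' (opposite k' i) (x 0) = 0 := by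
      intro i
      rcases hoppk i with h1 | h1 | h1 <;> rw [h1]
      · simp [(hxt 0).1]
      · simp [(hxt 0).2.1]
      · simp [(hxt 0).2.2]
    have hcontf : ∀ m, Continuous fun t => face f f' m (x t) := fun m =>
      (face f f' m).continuous_of_finiteDimensional.comp hx
    have hne0 : ∀ m, (∀ i, opposite m i = opposite k' i) → face f f' m (x 0) ≠ 0 := fun m hm =>
      h.face_vertex_ne_zero hx0 fun i => by rw [hm, hx0v]
    refine ⟨div_ne_zero (mul_ne_zero hβ hγ) hα, ?_, ?_⟩
    · simp only [eval_facesForm, Finset.prod_ne_zero_iff, Finset.mem_univ, forall_const]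
      refine Filter.eventually_all.2 fun m => ?_
      rcases hopp m with (rfl | rfl | rfl) | hm
      · filter_upwards [self_mem_nhdsWithin] with t ht
        rw [(hxt t).1]
        exact mul_ne_zero hα (pow_ne_zero _ ht)
      · filter_upwards [self_mem_nhdsWithin] with t ht
        rw [(hxt t).2.1]
        exact mul_ne_zero hβ ht
      · filter_upwards [self_mem_nhdsWithin] with t ht
        rw [(hxt t).2.2]
        exact mul_ne_zero hγ ht
      · exact ((hcontf m).continuousAt.eventually_ne (hne0 m hm)).filter_mono
          nhdsWithin_le_nhds
    · have hx0c := h.eq_smul_vertex k' hv0 hv hx0v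
      have hlimv : (β * γ / α) • ((0, Pi.single k 1) : (Fin 4 → ℂ) × (Fin 3 ⊕ Fin 3 → ℂ)) +
          (face f f' k' (x 0) / face f f' k' v) • (v, ratio f f' v) =
          (x 0, (β * γ / α) • Pi.single k 1 + ratio f f' (x 0)) := by
        rw [Prod.smul_mk _ v, ← ratio_smul, ← hx0c]
        simp
      simp only [one_smul]
      rw [hlimv]
      refine Filter.Tendsto.prodMk_nhds ((hx.tendsto 0).mono_left nhdsWithin_le_nhds)
        (tendsto_pi_nhds.2 fun m => ?_)
      have hpow : ∀ c : ℂ, Filter.Tendsto (fun t : ℂ => c * t ^ 2) (𝓝[≠] 0) (𝓝 0) := fun c => by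
        have : Continuous fun t : ℂ => c * t ^ 2 := by fun_prop
        simpa using (this.tendsto 0).mono_left nhdsWithin_le_nhds
      rcases hopp m with hm | hm
      · have hr0 : ratio f f' (x 0) m = 0 := by
          obtain ⟨i, rfl⟩ := hmem m hm
          exact ratio_eq_zero hx0v i
        rw [Pi.add_apply, hr0, add_zero]
        rcases hm with rfl | rfl | rfl
        · refine tendsto_const_nhds.congr' ?_
          filter_upwards [self_mem_nhdsWithin] with t ht
          have ht' : t ≠ 0 := ht
          rw [ratio, (hxt t).1, (hxt t).2.1, (hxt t).2.2]
          simp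
          field_simp
        · simp only [Pi.smul_apply, Pi.single_eq_of_ne hne1, smul_zero]
          refine (hpow (γ * α / β)).congr' ?_
          filter_upwards [self_mem_nhdsWithin] with t ht
          have ht' : t ≠ 0 := ht
          rw [ratio, mate₁_mate₁, mate₂_mate₁, (hxt t).1, (hxt t).2.1, (hxt t).2.2]
          field_simp
        · simp only [Pi.smul_apply, Pi.single_eq_of_ne hne2, smul_zero]
          refine (hpow (α * β / γ)).congr' ?_
          filter_upwards [self_mem_nhdsWithin] with t ht
          have ht' : t ≠ 0 := ht
          rw [ratio, mate₁_mate₂, mate₂_mate₂, (hxt t).1, (hxt t).2.1, (hxt t).2.2]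
          field_simp
      · have hmk : m ≠ k := by
          clear * - hm hkk'; revert k k' m; decide
        simp only [Pi.add_apply, Pi.smul_apply, Pi.single_eq_of_ne hmk, smul_zero, zero_add]
        have : ContinuousAt (fun t => ratio f f' (x t) m) 0 :=
          ((hcontf _).continuousAt.mul (hcontf _).continuousAt).div (hcontf _).continuousAt
            (hne0 m hm)
        exact this.tendsto.mono_left nhdsWithin_le_nhds
  · intro s t hs ht
    refine ⟨1, 1, s, t • v, one_ne_zero, one_ne_zero, hs, smul_ne_zero ht hv0, ?_, ?_, ?_, ?_, ?_⟩
    · obtain ⟨i, hi⟩ := hmem k (Or.inl rfl)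
      rw [hi, map_smul, hv, smul_zero]
    · obtain ⟨i, hi⟩ := hmem (mate₁ k) (Or.inr (Or.inl rfl))
      rw [hi, map_smul, hv, smul_zero]
    · obtain ⟨i, hi⟩ := hmem (mate₂ k) (Or.inr (Or.inr rfl))
      rw [hi, map_smul, hv, smul_zero]
    · simp
    · simp [hvk']

/-- The exceptional divisor over the intersection of an edge of one trihedron with a face of the
other one. -/
theorem GeneralPosition.exceptionalImage_edge_face (h : GeneralPosition f f')
    (b : Module.Basis (Fin 10) ℂ (septics f f')) {k k' : Fin 3 ⊕ Fin 3}
    (hkk' : k.isLeft ≠ k'.isLeft) (hP hQ) :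
    exceptionalImage b (face f f' k) (face f f' (mate₁ k)) (face f f' k') =
      joiningLine (h.point b (0, Pi.single k 1) hP) (h.point b (0, Pi.single k' 1) hQ) := by
  have hinj : ∀ m, m = mate₂ k ∨ m = mate₁ k' ∨ m = mate₂ k' →
      Function.Injective ![k, mate₁ k, k', m] := by
    clear * - hkk'; revert k k'; decide
  have hall : ∀ m, m = k ∨ m = mate₁ k ∨ m = mate₂ k ∨ m = k' ∨ m = mate₁ k' ∨
      m = mate₂ k' := by
    clear * - hkk'; revert k k'; decide
  have hne : k ≠ k' ∧ mate₁ k ≠ k ∧ mate₁ k ≠ k' ∧ mate₂ k ≠ k ∧ mate₂ k ≠ k' ∧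
      mate₁ k' ≠ k ∧ mate₁ k' ≠ k' ∧ mate₂ k' ≠ k ∧ mate₂ k' ≠ k' := by
    clear * - hkk'; revert k k'; decide
  obtain ⟨hn, n1, n1', n2, n2', n3, n3', n4, n4'⟩ := hne
  have hLI : LinearIndependent ℂ
      ![((0, Pi.single k 1) : (Fin 4 → ℂ) × (Fin 3 ⊕ Fin 3 → ℂ)), (0, Pi.single k' 1)] := by
    refine LinearIndependent.pair_iff.2 fun s t hst => ?_
    have h1 := congrFun (congrArg Prod.snd hst) k
    have h2 := congrFun (congrArg Prod.snd hst) k'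
    simp [hn, hn.symm] at h1 h2
    exact ⟨h1, h2⟩
  have hne0 : ∀ o, o ≠ 0 → face f f' k o = 0 → face f f' (mate₁ k) o = 0 → face f f' k' o = 0 →
      ∀ m, m = mate₂ k ∨ m = mate₁ k' ∨ m = mate₂ k' → face f f' m o ≠ 0 := by
    intro o ho h1 h2 h3 m hm h4
    refine ho (h.eq_zero (hinj m hm) fun i => ?_)
    fin_cases i
    · exact h1
    · exact h2
    · exact h3
    · exact h4
  refine h.exceptionalImage_eq_joiningLine b (hinj _ (Or.inl rfl)) hP hQ hLI
    (fun α β _ o => β * face f f' (mate₂ k) o / α)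
    (fun _ _ γ o => face f f' (mate₁ k') o * face f f' (mate₂ k') o / γ)
    (ε := fun t => t) (fun _ ht => ht) ?_ ?_
  · rintro α β γ hα hβ hγ x ⟨hx, hx0, hxt⟩
    have hcontf : ∀ m, Continuous fun t => face f f' m (x t) := fun m =>
      (face f f' m).continuous_of_finiteDimensional.comp hx
    have hm0 := hne0 (x 0) hx0 (by simp [(hxt 0).1]) (by simp [(hxt 0).2.1])
      (by simp [(hxt 0).2.2])
    have hk2 := hm0 (mate₂ k) (Or.inl rfl)
    have hk1' := hm0 (mate₁ k') (Or.inr (Or.inl rfl))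
    have hk2' := hm0 (mate₂ k') (Or.inr (Or.inr rfl))
    have hev : ∀ m, face f f' m (x 0) ≠ 0 → ∀ᶠ t in 𝓝[≠] 0, face f f' m (x t) ≠ 0 := fun m hm =>
      ((hcontf m).continuousAt.eventually_ne hm).filter_mono nhdsWithin_le_nhds
    refine ⟨div_ne_zero (mul_ne_zero hβ hk2) hα, ?_, ?_⟩
    · simp only [eval_facesForm, Finset.prod_ne_zero_iff, Finset.mem_univ, forall_const]
      refine Filter.eventually_all.2 fun m => ?_
      rcases hall m with rfl | rfl | rfl | rfl | rfl | rfl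
      · filter_upwards [self_mem_nhdsWithin] with t ht
        rw [(hxt t).1]
        exact mul_ne_zero hα (pow_ne_zero _ ht)
      · filter_upwards [self_mem_nhdsWithin] with t ht
        rw [(hxt t).2.1]
        exact mul_ne_zero hβ ht
      · exact hev _ hk2
      · filter_upwards [self_mem_nhdsWithin] with t ht
        rw [(hxt t).2.2]
        exact mul_ne_zero hγ ht
      · exact hev _ hk1'
      · exact hev _ hk2'
    · -- On the arc, the rescaled ratios extend continuously to `t = 0`.
      have hlimc : ∀ {r r₀ : ℂ → ℂ} {c : ℂ}, ContinuousAt r₀ 0 → r₀ 0 = c →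
          (∀ t, t ≠ 0 → r₀ t = r t) → Filter.Tendsto r (𝓝[≠] 0) (𝓝 c) := by
        rintro r r₀ c hr rfl hrr
        refine (hr.tendsto.mono_left nhdsWithin_le_nhds).congr' ?_
        filter_upwards [self_mem_nhdsWithin] with t ht
        exact hrr t ht
      have hc2 := (hcontf (mate₂ k)).continuousAt (x := 0)
      have hc1' := (hcontf (mate₁ k')).continuousAt (x := 0)
      have hc2' := (hcontf (mate₂ k')).continuousAt (x := 0)
      have hid : ContinuousAt (fun t : ℂ => t) 0 := continuousAt_id
      refine Filter.Tendsto.prodMk_nhds ?_ (tendsto_pi_nhds.2 fun m => ?_)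
      · exact ((continuous_id.smul hx).tendsto' 0 _ (by simp)).mono_left nhdsWithin_le_nhds
      rcases hall m with rfl | rfl | rfl | rfl | rfl | rfl
      · refine hlimc (r₀ := fun t => β * face f f' (mate₂ m) (x t) / α)
          ((continuousAt_const.mul hc2).div_const _) (by simp [hn]) fun t ht => ?_
        simp only [Pi.smul_apply, smul_eq_mul, ratio, (hxt t).1, (hxt t).2.1]
        field_simp
      · refine hlimc (r₀ := fun t => t ^ 2 * (α * face f f' (mate₂ k) (x t) / β))
          ((hid.pow 2).mul ((continuousAt_const.mul hc2).div_const _)) (by simp [n1, n1'])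
          fun t ht => ?_
        simp only [Pi.smul_apply, smul_eq_mul, ratio, mate₁_mate₁, mate₂_mate₁,
          (hxt t).1, (hxt t).2.1]
        field_simp
      · refine hlimc (r₀ := fun t => t ^ 4 * (α * β / face f f' (mate₂ k) (x t)))
          ((hid.pow 4).mul (continuousAt_const.div hc2 hk2)) (by simp [n2, n2'])
          fun t ht => ?_
        simp only [Pi.smul_apply, smul_eq_mul, ratio, mate₁_mate₂, mate₂_mate₂,
          (hxt t).1, (hxt t).2.1]
        ring
      · refine hlimc (r₀ := fun t => face f f' (mate₁ m) (x t) * face f f' (mate₂ m) (x t) / γ)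
          ((hc1'.mul hc2').div_const _) (by simp [hn.symm]) fun t ht => ?_
        simp only [Pi.smul_apply, smul_eq_mul, ratio, (hxt t).2.2]
        field_simp
      · refine hlimc (r₀ := fun t => t ^ 2 * (γ * face f f' (mate₂ k') (x t) /
          face f f' (mate₁ k') (x t)))
          ((hid.pow 2).mul ((continuousAt_const.mul hc2').div hc1' hk1')) (by simp [n3, n3'])
          fun t ht => ?_
        simp only [Pi.smul_apply, smul_eq_mul, ratio, mate₁_mate₁, mate₂_mate₁,
          (hxt t).2.2]
        ring
      · refine hlimc (r₀ := fun t => t ^ 2 * (γ * face f f' (mate₁ k') (x t) /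
          face f f' (mate₂ k') (x t)))
          ((hid.pow 2).mul ((continuousAt_const.mul hc1').div hc2' hk2')) (by simp [n4, n4'])
          fun t ht => ?_
        simp only [Pi.smul_apply, smul_eq_mul, ratio, mate₁_mate₂, mate₂_mate₂,
          (hxt t).2.2]
        ring
  · intro s t hs ht
    obtain ⟨o, ho⟩ := h.exists_point (hinj _ (Or.inl rfl)) ![0, 0, 0, 1]
    have ho4 : face f f' (mate₂ k) o = 1 := ho 3
    have ho0 : o ≠ 0 := by
      rintro rfl
      rw [map_zero] at ho4
      exact zero_ne_one ho4
    have hm0 := hne0 o ho0 (ho 0) (ho 1) (ho 2)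
    have hk1' := hm0 (mate₁ k') (Or.inr (Or.inl rfl))
    have hk2' := hm0 (mate₂ k') (Or.inr (Or.inr rfl))
    refine ⟨1, s, face f f' (mate₁ k') o * face f f' (mate₂ k') o / t, o, one_ne_zero, hs,
      div_ne_zero (mul_ne_zero hk1' hk2') ht, ho0, ho 0, ho 1, ho 2, by simp [ho4], ?_⟩
    field_simp

/-! ### The line that is the image of the line joining the vertices -/

theorem ratio_add_vertices (hv : ∀ i, f i v = 0) (hv' : ∀ i, f' i v' = 0) (s t : ℂ) :
    ratio f f' (s • v' + t • v) = s • ratio f f' v' + t • ratio f f' v := by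
  ext k
  rcases k with i | i
  · have h1 : ratio f f' (s • v' + t • v) (Sum.inl i) = ratio f f' (s • v') (Sum.inl i) := by
      simp [ratio, mate₁, mate₂, hv]
    have h2 : ratio f f' v (Sum.inl i) = 0 := ratio_eq_zero (k := Sum.inr 0) hv i
    rw [h1, ratio_smul, Pi.add_apply, Pi.smul_apply _ (ratio f f' v), h2, smul_zero, add_zero]
  · have h1 : ratio f f' (s • v' + t • v) (Sum.inr i) = ratio f f' (t • v) (Sum.inr i) := by
      simp [ratio, mate₁, mate₂, hv']
    have h2 : ratio f f' v' (Sum.inr i) = 0 := ratio_eq_zero (k := Sum.inl 0) hv' i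
    rw [h1, ratio_smul, Pi.add_apply, Pi.smul_apply _ (ratio f f' v'), h2, smul_zero, zero_add]

theorem GeneralPosition.nu_eq_zero (h : GeneralPosition f f')
    (b : Module.Basis (Fin 10) ℂ (septics f f')) (k : Fin 3 ⊕ Fin 3) {x : Fin 4 → ℂ}
    (hx : ∀ i, face f f' (opposite k i) x = 0) : nu b x = 0 := by
  apply (h.coords b).injective
  rw [h.coords_nu, map_zero, eval_facesForm_eq_zero (hx 0), zero_smul]
  refine Prod.ext rfl (funext fun m => ?_)
  obtain ⟨i, hi⟩ : ∃ i, opposite k i ≠ m := by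
    clear * -; revert k m; decide
  exact eval_faceSeptic_eq_zero hi (hx i)

theorem GeneralPosition.closedImage_vertexLine (h : GeneralPosition f f')
    (b : Module.Basis (Fin 10) ℂ (septics f f'))
    (hv0 : v ≠ 0) (hv : ∀ i, f i v = 0) (hv0' : v' ≠ 0) (hv' : ∀ i, f' i v' = 0) (hP hQ) :
    closedImage b (vertexLine f f') =
      joiningLine (h.point b (v', ratio f f' v') hP) (h.point b (v, ratio f f' v) hQ) := by
  have hne : ∀ i, f' i v ≠ 0 := fun i => h.face_vertex_ne_zero (k := Sum.inr i) hv0 hv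
  have hne' : ∀ i, f i v' ≠ 0 := fun i => h.face_vertex_ne_zero (k := Sum.inl i) hv0' hv'
  have hD : ∀ s t : ℂ, s ≠ 0 → t ≠ 0 → eval (s • v' + t • v) (facesForm f f') ≠ 0 := by
    intro s t hs ht
    rw [eval_facesForm, Finset.prod_ne_zero_iff]
    rintro (i | i) -
    · simp [hv, hs, hne']
    · simp [hv', ht, hne]
  have hnu : ∀ s t : ℂ, s ≠ 0 → t ≠ 0 → nu b (s • v' + t • v) =
      eval (s • v' + t • v) (facesForm f f') • (s • (h.coords b).symm (v', ratio f f' v') +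
        t • (h.coords b).symm (v, ratio f f' v)) := by
    intro s t hs ht
    apply (h.coords b).injective
    rw [h.coords_nu_eq_smul b (hD s t hs ht), ratio_add_vertices hv hv']
    simp
  refine zariskiClosure_eq_joiningLine _ _ ?_ ?_ ?_
  · rintro p ⟨x, ⟨u, w, hu, hw, rfl⟩, hx, rfl⟩
    have hu' := h.eq_smul_vertex (Sum.inr 0) hv0 hv hu
    have hw' := h.eq_smul_vertex (Sum.inl 0) hv0' hv' hw
    set t := face f f' (Sum.inr 0) u / face f f' (Sum.inr 0) v
    set s := face f f' (Sum.inl 0) w / face f f' (Sum.inl 0) v'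
    have hs : s ≠ 0 := by
      rintro h0
      refine hx (h.nu_eq_zero b (Sum.inr 0) fun i => ?_)
      rw [hw', h0, zero_smul, add_zero]
      exact hu i
    have ht : t ≠ 0 := by
      rintro h0
      refine hx (h.nu_eq_zero b (Sum.inl 0) fun i => ?_)
      rw [hu', h0, zero_smul, zero_add]
      exact hw i
    refine (mk_mem_joiningLine _ _ hx).2
      ⟨eval (s • v' + t • v) (facesForm f f') * s, eval (s • v' + t • v) (facesForm f f') * t, ?_⟩
    rw [hu', hw', add_comm, hnu s t hs ht, smul_add, smul_smul, smul_smul]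
  · intro s t hs ht hst
    refine ⟨s • v' + t • v, ⟨t • v, s • v', fun i => ?_, fun i => ?_, add_comm _ _⟩,
      h.nu_ne_zero b (hD s t hs ht), ?_⟩
    · rw [map_smul, hv, smul_zero]
    · rw [map_smul, hv', smul_zero]
    · refine ((Projectivization.mk_eq_mk_iff' ℂ _ _ _ _).2
        ⟨eval (s • v' + t • v) (facesForm f f'), ?_⟩).symm
      rw [hnu s t hs ht]
  · have hLI := (h.linearIndependent_node hv0 hv hv0' hv').comp
      ![Sum.inl none, Sum.inr none] (by decide)
    have := hLI.map' (h.coords b).symm.toLinearMap (LinearEquiv.ker _)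
    convert! this using 1
    ext i
    fin_cases i <;> rfl

/-! ### The nodes are singular and joined by lines of the image -/

theorem IsDistinguishedImage.subset (b : Module.Basis (Fin 10) ℂ (septics f f'))
    {L : Set (PSpace 10)} (hL : IsDistinguishedImage b L) : L ⊆ fanoThreefold b := by
  have hexc : ∀ g₁ g₂ g₃, exceptionalImage b g₁ g₂ g₃ ⊆ fanoThreefold b := by
    intro g₁ g₂ g₃
    refine zariskiClosure_subset ?_
    rintro p ⟨α, β, γ, -, -, -, x, -, -, -, c, hc⟩
    exact mem_zariskiClosure_of_tendsto hc fun t ht => mk_nu_mem b ht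
  cases hL with
  | gamma => exact hexc _ _ _
  | gamma' => exact hexc _ _ _
  | lambda => exact hexc _ _ _
  | lambda' => exact hexc _ _ _
  | vertices =>
    refine zariskiClosure_subset fun p hp => ?_
    obtain ⟨x, -, hx, rfl⟩ := hp
    exact subset_zariskiClosure _ ⟨x, trivial, hx, rfl⟩

/-- If the closed set `W` contains a line, then the directions of the line are tangent to the cone
over `W` at all points of the line. -/
theorem mem_coneTangentSpace_of_joiningLine {n : ℕ} {W : Set (PSpace n)} {a c w : Fin n → ℂ}
    (ha : a ≠ 0) (hc : c ≠ 0)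
    (hW : joiningLine (.mk ℂ a ha) (.mk ℂ c hc) ⊆ W) (hw : ∃ s t : ℂ, w = s • a + t • c) :
    w ∈ coneTangentSpace W (.mk ℂ a ha) := by
  obtain ⟨s, t, rfl⟩ := hw
  obtain ⟨u, hu⟩ := Projectivization.exists_smul_eq_mk_rep ℂ a ha
  intro F hF
  have h1 := hasDerivAt_eval_line F (Projectivization.mk ℂ a ha).rep (s • a + t • c)
  refine h1.unique ((hasDerivAt_const (0 : ℂ) (0 : ℂ)).congr_of_eventuallyEq ?_)
  have hcont : Continuous fun r : ℂ =>
      (Projectivization.mk ℂ a ha).rep + r • (s • a + t • c) := by fun_prop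
  have hne := hcont.continuousAt.eventually_ne (x := 0) (y := 0)
    (by simpa using (Projectivization.mk ℂ a ha).rep_nonzero)
  filter_upwards [hne] with r hr
  refine mem_homogeneousIdeal.1 hF _ hr (hW ((mk_mem_joiningLine ha hc hr).2
    ⟨u + r * s, r * t, ?_⟩))
  rw [← hu, Units.smul_def]
  module

section

variable (h : GeneralPosition f f') (b : Module.Basis (Fin 10) ℂ (septics f f'))
  (hv0 : v ≠ 0) (hv : ∀ i, f i v = 0) (hv0' : v' ≠ 0) (hv' : ∀ i, f' i v' = 0)
include hv0 hv hv0' hv'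

theorem GeneralPosition.isDistinguishedImage_joiningLine
    (hne : ∀ n, node f f' v v' n ≠ 0) (n : Option (Fin 3) ⊕ Option (Fin 3))
    (m : Option (Fin 3)) :
    IsDistinguishedImage b
      (joiningLine (h.point b _ (hne n)) (h.point b _ (hne (across n m)))) := by
  have key : ∀ m m', IsDistinguishedImage b
      (joiningLine (h.point b _ (hne (Sum.inl m))) (h.point b _ (hne (Sum.inr m')))) := by
    rintro (_ | i) (_ | j)
    · exact h.closedImage_vertexLine b hv0 hv hv0' hv' _ _ ▸ IsDistinguishedImage.vertices
    · rw [joiningLine_comm]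
      exact h.exceptionalImage_vertex b (k := Sum.inr j) (k' := Sum.inl 0) (by simp) hv0' hv' _ _ ▸
        IsDistinguishedImage.gamma' j (j + 1) (j + 2) (by revert j; decide) (by revert j; decide)
          (by revert j; decide)
    · exact h.exceptionalImage_vertex b (k := Sum.inl i) (k' := Sum.inr 0) (by simp) hv0 hv _ _ ▸
        IsDistinguishedImage.gamma i (i + 1) (i + 2) (by revert i; decide) (by revert i; decide)
          (by revert i; decide)
    · exact h.exceptionalImage_edge_face b (k := Sum.inl i) (k' := Sum.inr j) (by simp) _ _ ▸
        IsDistinguishedImage.lambda i (i + 1) j (by revert i; decide)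
  rcases n with n | n
  · exact key n m
  · rw [joiningLine_comm]
    exact key m n

theorem GeneralPosition.isSingularPoint_node (hne : ∀ n, node f f' v v' n ≠ 0)
    (n : Option (Fin 3) ⊕ Option (Fin 3)) :
    IsSingularPoint (fanoThreefold b) (h.point b _ (hne n)) := by
  have hline := fun m => (h.isDistinguishedImage_joiningLine b hv0 hv hv0' hv' hne n m).subset b
  refine ⟨hline none ((mk_mem_joiningLine _ _ _).2 ⟨1, 0, by simp⟩), ?_⟩
  rw [h.ringKrullDim_fanoThreefold]
  -- The node and the four nodes of the other group span a five-dimensional space of tangent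
  -- vectors.
  let e : Option (Option (Fin 3)) → Option (Fin 3) ⊕ Option (Fin 3) := fun o =>
    o.elim n (across n)
  have he : Function.Injective e := by
    clear * -; revert n; decide
  have hmem : ∀ o, (h.coords b).symm (node f f' v v' (e o)) ∈
      coneTangentSpace (fanoThreefold b) (h.point b _ (hne n)) := by
    rintro (_ | m)
    · exact mem_coneTangentSpace_of_joiningLine _ _ (hline none) ⟨1, 0, by simp [e]⟩
    · exact mem_coneTangentSpace_of_joiningLine _ _ (hline m) ⟨0, 1, by simp [e]⟩
  have hLI : LinearIndependent ℂ fun o =>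
      (⟨_, hmem o⟩ : coneTangentSpace (fanoThreefold b) (h.point b _ (hne n))) := by
    refine LinearIndependent.of_comp (Submodule.subtype _) ?_
    exact ((h.linearIndependent_node hv0 hv hv0' hv').comp e he).map'
      (h.coords b).symm.toLinearMap (LinearEquiv.ker _)
  have h5 := hLI.fintype_card_le_finrank
  have hc : Fintype.card (Option (Option (Fin 3))) = 5 := rfl
  rw [hc] at h5
  have h4 : 4 < Module.finrank ℂ
      (coneTangentSpace (fanoThreefold b) (h.point b _ (hne n))) := by omega
  exact_mod_cast h4

end

end Nodes

end FanoGenusNine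

theorem mainTheorem9 (f f' : Fin 3 → Module.Dual ℂ (Fin 4 → ℂ))
    (hff' : FanoGenusNine.GeneralPosition f f') :
    Module.finrank ℂ (FanoGenusNine.septics f f') = 10 ∧
    ∀ b : Module.Basis (Fin 10) ℂ (FanoGenusNine.septics f f'),
      ∀ p, FanoGenusNine.IsSingularPoint (FanoGenusNine.fanoThreefold b) p →
        4 ≤ {q | FanoGenusNine.IsSingularPoint (FanoGenusNine.fanoThreefold b) q ∧
          FanoGenusNine.AreAssociated (FanoGenusNine.fanoThreefold b) p q ∧
          FanoGenusNine.IsDistinguishedImage b (FanoGenusNine.joiningLine p q)}.encard := by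
  refine ⟨hff'.finrank_septics, fun b p hp => ?_⟩
  obtain ⟨v, hv0, hv⟩ := hff'.exists_vertex (Sum.inr 0)
  obtain ⟨v', hv0', hv'⟩ := hff'.exists_vertex (Sum.inl 0)
  have hLI := hff'.linearIndependent_node hv0 hv hv0' hv'
  have hne := hLI.ne_zero
  have hinj : ∀ n n', hff'.point b _ (hne n) = hff'.point b _ (hne n') → n = n' := fun _ _ =>
    hff'.eq_of_point_node_eq b hv0 hv hv0' hv'
  obtain ⟨n, c, hc⟩ := hff'.eq_node_of_isSingularPoint b hv0 hv hv0' hv' hp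
  obtain rfl := hff'.eq_point b (hne n) hc
  have hacross : Function.Injective (FanoGenusNine.across n) := by
    clear * -; revert n; decide
  have hacross' : ∀ m, n ≠ FanoGenusNine.across n m := by
    clear * -; revert n; decide
  have hcard : (Set.range fun m => hff'.point b _ (hne (FanoGenusNine.across n m))).encard = 4 := by
    rw [← Set.image_univ, Function.Injective.encard_image fun m m' hm => hacross (hinj _ _ hm),
      Set.encard_univ]
    simp
  rw [← hcard]
  refine Set.encard_le_encard ?_
  rintro _ ⟨m, rfl⟩
  have hd := hff'.isDistinguishedImage_joiningLine b hv0 hv hv0' hv' hne n m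
  exact ⟨hff'.isSingularPoint_node b hv0 hv hv0' hv' hne _,
    ⟨fun hnm => hacross' m (hinj _ _ hnm), hd.subset b⟩, hd⟩
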